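/- Let $\Gamma$ be a compact connected metric graph with at least one edge and without loops or multiple edges: finite sets $V$ of vertices and $E\neq\emptyset$ of edges, each edge $e$ oriented from a vertex $i_e$ to a vertex $f_e$ and identified with an interval $[0,\ell_e]$, $0<\ell_e<\infty$. A function $u$ on $\Gamma$ is a family $([u]_e)_{e\in E}$ of functions of the coordinate $x_e$; write $\int_\Gamma u=\sum_e\int_0^{\ell_e}[u]_e\,dx_e$, and let $\ell(A)$ be the total Lebesgue measure of $A\subset\Gamma$. Let $W^{k,2}(\Gamma)$ be the set of $u$ with $[u]_e\in W^{k,2}(0,\ell_e)$ for all $e$ (no condition at the vertices); functions in $W^{1,2}(\Gamma)$ are represented by their continuous representatives on each $[0,\ell_e]$. Say that $z\in W^{1,2}(\Gamma)$ satisfies the Kirchhoff condition if $\sum_{e:\,f_e=v}[z]_e(\ell_e)-\sum_{e:\,i_e=v}[z]_e(0)=0$ for every $v\in V$, and let $X_K(\Gamma)$ be the set of such $z$. For a measurable $D\subset\Gamma$ put $$\mathrm{Per}_\Gamma(D)=\sup\Big\{\Big|\int_D z'\,dx\Big| : z\in X_K(\Gamma),\ \|z\|_{L^\infty(\Gamma)}\le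 1\Big\}\in[0,\infty],$$ $$h(\Gamma)=\inf\Big\{\frac{\mathrm{Per}_\Gamma(D)}{\min\{\ell(D),\ell(\Gamma\setminus D)\}} : D\subset\Gamma \text{ measurable},\ 0<\ell(D)<\ell(\Gamma)\Big\}.$$ Let $\Delta_\Gamma$ be the Kirchhoff Laplacian: its domain consists of the $u\in W^{2,2}(\Gamma)$ that are continuous on $\Gamma$ (including at the vertices) and whose derivative $u'$ satisfies the Kirchhoff condition, and $[\Delta_\Gamma u]_e=[u]_e''$. Theorem. The operator $-\Delta_\Gamma$ has a smallest nonzero eigenvalue $\mathrm{gap}(-\Delta_\Gamma)$, it is given by $$\mathrm{gap}(-\Delta_\Gamma)=\min\Big\{\frac{\int_\Gamma |u'|^2}{\int_\Gamma |u|^2} : u\in W^{1,2}(\Gamma) \text{ continuous on } \Gamma,\ u\not\equiv 0,\ \int_\Gamma u=0\Big\},$$ and the Cheeger inequality holds: $$\tfrac14\,h(\Gamma)^2\le \mathrm{gap}(-\Delta_\Gamma).$$ -/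

import Mathlib

open MeasureTheory Set
open scoped ENNReal ContDiff

/-- A metric graph with vertex set `V`, edge set `E`, and edges of finite positive length, without
loops and without multiple edges. Each edge `e` is oriented from `source e` to `target e` and is
identified with the interval `[0, len e]`. (It is compact when `V` and `E` are finite.) -/
structure MetricGraph (V E : Type*) where
  source : E → V
  target : E → V
  len : E → ℝ
  len_pos : ∀ e, 0 < len e
  no_loops : ∀ e, source e ≠ target e
  no_multiple_edges : Function.Injective fun e => s(source e, target e)

/-- `u` is the continuous representative on `[0, L]` of an element of the Sobolev space
`W^{1,2}(0, L)`, and `g ∈ L²(0, L)` is its weak derivative. -/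
structure IsSobolev (L : ℝ) (u g : ℝ → ℝ) : Prop where
  continuousOn : ContinuousOn u (Icc 0 L)
  memLp : MemLp g 2 (volume.restrict (Ioo 0 L))
  weak_deriv : ∀ φ : ℝ → ℝ, ContDiff ℝ ∞ φ → HasCompactSupport φ → tsupport φ ⊆ Ioo 0 L →
    ∫ x in 0..L, u x * deriv φ x = -∫ x in 0..L, g x * φ x

namespace MetricGraph

variable {V E : Type*}

/-- The underlying combinatorial graph. -/
def toSimpleGraph (Γ : MetricGraph V E) : SimpleGraph V :=
  SimpleGraph.fromEdgeSet (range fun e => s(Γ.source e, Γ.target e))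

/-- The points of the metric graph: the vertices and the interior points of the edges. -/
inductive Point (Γ : MetricGraph V E) where
  | vertex (v : V) : Point Γ
  | inner (e : E) (x : Ioo (0 : ℝ) (Γ.len e)) : Point Γ

open Classical in
/-- The point of the edge `e` with coordinate `x ∈ [0, len e]`. -/
noncomputable def point (Γ : MetricGraph V E) (e : E) (x : ℝ) : Γ.Point :=
  if hx : x ∈ Ioo 0 (Γ.len e) then .inner e ⟨x, hx⟩
  else if x ≤ 0 then .vertex (Γ.source e) else .vertex (Γ.target e)

/-- The set of coordinates, in `[0, len e]`, of the points of `A` on the edge `e`. -/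
def coords (Γ : MetricGraph V E) (A : Set Γ.Point) (e : E) : Set ℝ :=
  {x | x ∈ Icc 0 (Γ.len e) ∧ Γ.point e x ∈ A}

/-- A subset of the graph is measurable if it is Lebesgue measurable on every edge. -/
def IsMeasurable (Γ : MetricGraph V E) (A : Set Γ.Point) : Prop :=
  ∀ e, NullMeasurableSet (Γ.coords A e) volume

/-- The indicator function of a set, as a family of functions of the edge coordinates. -/
noncomputable def indicator (Γ : MetricGraph V E) (A : Set Γ.Point) : E → ℝ → ℝ :=
  fun e => (Γ.coords A e).indicator 1

/-- The functions `u e` on `[0, len e]` form an element of `W^{1,2}` of the graph (given by its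
continuous representative on each closed edge; no continuity at the vertices is required), and the
functions `g e` form its derivative. -/
def IsW12 (Γ : MetricGraph V E) (u g : E → ℝ → ℝ) : Prop :=
  ∀ e, IsSobolev (Γ.len e) (u e) (g e)

/-- The limits of `u` at a vertex along all edges incident to it agree. -/
def ContinuousAtVertices (Γ : MetricGraph V E) (u : E → ℝ → ℝ) : Prop :=
  ∃ c : V → ℝ, ∀ e, u e 0 = c (Γ.source e) ∧ u e (Γ.len e) = c (Γ.target e)

section Finite

variable [Fintype E]

/-- The length of a subset of the graph. -/
noncomputable def length (Γ : MetricGraph V E) (A : Set Γ.Point) : ℝ≥0∞ :=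
  ∑ e, volume (Γ.coords A e)

/-- The integral of a function over the graph. -/
noncomputable def integral (Γ : MetricGraph V E) (u : E → ℝ → ℝ) : ℝ :=
  ∑ e, ∫ x in 0..Γ.len e, u e x

open Classical in
/-- The Kirchhoff condition: at every vertex `v`, the values of `z` at `v` along the incident edges,
with sign `+` at a terminal point and `-` at an initial point of the edge, sum to zero. -/
def Kirchhoff (Γ : MetricGraph V E) (z : E → ℝ → ℝ) : Prop :=
  ∀ v, ∑ e, ((if Γ.target e = v then z e (Γ.len e) else 0)
    - (if Γ.source e = v then z e 0 else 0)) = 0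

/-- The total variation of `u`: the supremum of `|∫ u z'|` over all `z` in `W^{1,2}` which satisfy
the Kirchhoff condition and `‖z‖_∞ ≤ 1`. -/
noncomputable def totalVariation (Γ : MetricGraph V E) (u : E → ℝ → ℝ) : ℝ≥0∞ :=
  ⨆ (z : E → ℝ → ℝ) (g : E → ℝ → ℝ) (_ : Γ.IsW12 z g) (_ : Γ.Kirchhoff z)
    (_ : ∀ e, ∀ x ∈ Icc 0 (Γ.len e), |z e x| ≤ 1),
    ENNReal.ofReal |Γ.integral fun e x => u e x * g e x|

/-- The perimeter of a measurable set (it is `∞` exactly when the set is not of finite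
perimeter). -/
noncomputable def perimeter (Γ : MetricGraph V E) (D : Set Γ.Point) : ℝ≥0∞ :=
  Γ.totalVariation (Γ.indicator D)

/-- The Cheeger constant of the graph. Sets of infinite perimeter do not affect the infimum. -/
noncomputable def cheegerConstant (Γ : MetricGraph V E) : ℝ≥0∞ :=
  ⨅ (D : Set Γ.Point) (_ : Γ.IsMeasurable D) (_ : 0 < Γ.length D)
    (_ : Γ.length D < Γ.length univ),
    Γ.perimeter D / min (Γ.length D) (Γ.length Dᶜ)

/-- `u` lies in the domain of the Kirchhoff Laplacian (it is in `W^{2,2}`, continuous, and its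
outward normal derivatives at each vertex sum to zero), and its Laplacian is `f`. -/
def IsLaplacian (Γ : MetricGraph V E) (u f : E → ℝ → ℝ) : Prop :=
  ∃ g : E → ℝ → ℝ, Γ.IsW12 u g ∧ Γ.IsW12 g f ∧ Γ.ContinuousAtVertices u ∧ Γ.Kirchhoff g

/-- `μ` is an eigenvalue of minus the Kirchhoff Laplacian. -/
def IsEigenvalue (Γ : MetricGraph V E) (μ : ℝ) : Prop :=
  ∃ u f : E → ℝ → ℝ, Γ.IsLaplacian u f ∧ Γ.integral (fun e x => u e x ^ 2) ≠ 0 ∧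
    ∀ e, ∀ᵐ x ∂volume.restrict (Ioo 0 (Γ.len e)), -f e x = μ * u e x

/-- The nonzero eigenvalues of minus the Kirchhoff Laplacian. -/
def nonzeroEigenvalues (Γ : MetricGraph V E) : Set ℝ :=
  {μ | μ ≠ 0 ∧ Γ.IsEigenvalue μ}

/-- The spectral gap: the first nonzero eigenvalue of minus the Kirchhoff Laplacian. -/
noncomputable def spectralGap (Γ : MetricGraph V E) : ℝ :=
  sInf Γ.nonzeroEigenvalues

/-- The Rayleigh quotients `∫ |u'|² / ∫ |u|²` of the nonzero mean-zero functions `u` in the form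
domain (the continuous functions in `W^{1,2}`). -/
def rayleighQuotients (Γ : MetricGraph V E) : Set ℝ :=
  {r | ∃ u g : E → ℝ → ℝ, Γ.IsW12 u g ∧ Γ.ContinuousAtVertices u ∧
    Γ.integral (fun e x => u e x ^ 2) ≠ 0 ∧ Γ.integral u = 0 ∧
    r = Γ.integral (fun e x => g e x ^ 2) / Γ.integral (fun e x => u e x ^ 2)}

end Finite

end MetricGraph

/-! Let λ be the infimum of the Rayleigh quotients of nonzero mean-zero functions in the form
domain.

The direct method shows that λ is attained (`exists_minimizer`). On a connected graph the sup norm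
of a mean-zero function is bounded by the L² norm of its derivative (`exists_sup_bound`), so a
normalized minimizing sequence is bounded and equi-Hölder of order 1/2 on each edge, and
Arzelà–Ascoli gives a subsequence converging pointwise. Its derivatives converge strongly in L²: the
parallelogram identity and the definition of λ, applied to sums of two members, make them Cauchy, so
no weak compactness is needed. The first variation of the quotient at a minimizer u vanishes.
Testing it inside one edge gives u'' = -λu, and testing it with the interpolation of a single vertex
value gives the Kirchhoff condition (`exists_eigenfunction`). Conversely, Green's formula tested
with the eigenfunction itself and with 1 shows that a nonzero eigenvalue is a Rayleigh quotient.
Since λ > 0 by the Poincaré bound, λ is the smallest nonzero eigenvalue.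

For Cheeger's inequality put v = u - m with m a median of u, and F = v|v|, which is C¹ on every
edge. For t > 0 the sets {F > t} and {-F > t} have at most half the total length, so h times their
length is at most their perimeter. Integrating in t, by the layer cake formula on one side and a
coarea inequality on the other (`lintegral_perimeter_superlevel_le`), yields h ∫v² ≤ 2 ∫|v||v'|. By
Cauchy–Schwarz, h² ∫v² ≤ 4 ∫|v'|² = 4λ, and ∫v² ≥ ∫u² = 1 because u has mean zero. The coarea
inequality comes from the dual definition of perimeter: the indicator of {F > t} is replaced by a
smooth step of F, Green's formula moves the derivative off the Kirchhoff field z, |z| ≤ 1 is used,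
and Fatou and Tonelli finish. -/

open Filter Topology

/-! ### Sobolev functions on an interval -/

/-- Integration by parts for primitives of integrable functions. -/
theorem integral_mul_add_mul_of_eq_add_integral {L : ℝ} (hL : 0 ≤ L) {u g w h : ℝ → ℝ}
    (hg : IntervalIntegrable g volume 0 L) (hh : IntervalIntegrable h volume 0 L)
    (hu : ∀ x ∈ Icc 0 L, u x = u 0 + ∫ t in 0..x, g t)
    (hw : ∀ x ∈ Icc 0 L, w x = w 0 + ∫ t in 0..x, h t) :
    ∫ x in 0..L, (g x * w x + u x * h x) = u L * w L - u 0 * w 0 := by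
  have key : ∀ {g : ℝ → ℝ} (c : ℝ), IntervalIntegrable g volume 0 L →
      AbsolutelyContinuousOnInterval (fun x => c + ∫ t in 0..x, g t) 0 L := by
    intro g c hg
    exact (((LipschitzWith.const c).lipschitzOnWith).absolutelyContinuousOnInterval).add
      (hg.absolutelyContinuousOnInterval_intervalIntegral (by simp))
  have h0 : (0 : ℝ) ∈ Icc 0 L := ⟨le_rfl, hL⟩
  have h1 : L ∈ Icc 0 L := ⟨hL, le_rfl⟩
  rw [hu L h1, hw L h1]
  have := (key (u 0) hg).integral_deriv_mul_eq_sub (key (w 0) hh)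
  simp only [intervalIntegral.integral_same, add_zero] at this
  rw [← this]
  apply intervalIntegral.integral_congr_ae
  filter_upwards [hg.ae_hasDerivAt_integral, hh.ae_hasDerivAt_integral] with x hx₁ hx₂ hx
  have hx' : x ∈ uIcc 0 L := uIoc_subset_uIcc hx
  have e1 := ((hx₁ hx' 0 (by simp)).const_add (u 0)).deriv
  have e2 := ((hx₂ hx' 0 (by simp)).const_add (w 0)).deriv
  rw [e1, e2, hu x (by rwa [uIcc_of_le hL] at hx'), hw x (by rwa [uIcc_of_le hL] at hx')]

theorem MeasureTheory.MemLp.intervalIntegrable_of_Ioo {L : ℝ} {g : ℝ → ℝ}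
    (hL : 0 ≤ L) (hg : MemLp g 2 (volume.restrict (Ioo 0 L))) :
    IntervalIntegrable g volume 0 L := by
  rw [intervalIntegrable_iff_integrableOn_Ioo_of_le hL]
  exact hg.integrable (by norm_num)

theorem intervalIntegral_eq_setIntegral_Ioo {L : ℝ} (hL : 0 ≤ L) (f : ℝ → ℝ) :
    ∫ x in 0..L, f x = ∫ x in Ioo 0 L, f x := by
  rw [intervalIntegral.integral_of_le hL, integral_Ioc_eq_integral_Ioo]

theorem eq_add_integral_of_contDiff {φ : ℝ → ℝ} (hφ : ContDiff ℝ ∞ φ) (x : ℝ) :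
    φ x = φ 0 + ∫ t in 0..x, deriv φ t := by
  rw [intervalIntegral.integral_deriv_eq_sub (fun y _ => (hφ.differentiable (by simp)) y)
    ((hφ.continuous_deriv (by simp)).intervalIntegrable _ _)]
  ring

theorem eq_zero_of_tsupport_subset_Ioo {L : ℝ} {φ : ℝ → ℝ} (h : tsupport φ ⊆ Ioo 0 L) {x : ℝ}
    (hx : x ∉ Ioo 0 L) : φ x = 0 :=
  image_eq_zero_of_notMem_tsupport fun hx' => hx (h hx')

/-- A smooth function with compact support in an interval and vanishing integral is the derivative
of a smooth function with compact support in the interval. -/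
theorem exists_primitive_hasCompactSupport {L : ℝ} {χ : ℝ → ℝ}
    (hχ : ContDiff ℝ ∞ χ) (hc : HasCompactSupport χ) (hs : tsupport χ ⊆ Ioo 0 L)
    (h0 : ∫ x in 0..L, χ x = 0) :
    ∃ φ : ℝ → ℝ, ContDiff ℝ ∞ φ ∧ HasCompactSupport φ ∧ tsupport φ ⊆ Ioo 0 L ∧
      deriv φ = χ := by
  rcases (tsupport χ).eq_empty_or_nonempty with hE | hne
  · refine ⟨0, contDiff_const, HasCompactSupport.zero, by simp [tsupport], ?_⟩
    have : χ = 0 := by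
      ext x
      exact image_eq_zero_of_notMem_tsupport (by simp [hE])
    rw [this]; ext x; simp [Pi.zero_def]
  obtain ⟨a, ha, ha'⟩ := (show IsCompact (tsupport χ) from hc).exists_isLeast hne
  obtain ⟨b, hb, hb'⟩ := (show IsCompact (tsupport χ) from hc).exists_isGreatest hne
  have hder : ∀ x, HasDerivAt (fun x => ∫ t in 0..x, χ t) (χ x) x := fun x =>
    (hχ.continuous.integral_hasStrictDerivAt 0 x).hasDerivAt
  have hderiv : deriv (fun x => ∫ t in 0..x, χ t) = χ := funext fun x => (hder x).deriv
  have haI := hs ha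
  have hbI := hs hb
  have hz : ∀ x, x < a ∨ b < x → χ x = 0 := by
    intro x hx
    apply image_eq_zero_of_notMem_tsupport
    intro hx'
    rcases hx with hx | hx
    · exact absurd (ha' hx') (not_le.2 hx)
    · exact absurd (hb' hx') (not_le.2 hx)
  -- Left of the support nothing has been accumulated; right of it the whole integral has, and that
  -- is zero.
  have hsub : tsupport (fun x => ∫ t in 0..x, χ t) ⊆ Icc a b := by
    refine closure_minimal ?_ isClosed_Icc
    intro x hx
    by_contra hxn
    apply hx
    have hor : x < a ∨ b < x := by
      by_contra! h
      exact hxn h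
    rcases hor with h | h
    · change ∫ t in 0..x, χ t = 0
      rw [intervalIntegral.integral_congr (g := fun _ => 0), intervalIntegral.integral_zero]
      intro t ht
      refine hz t (Or.inl (lt_of_le_of_lt ht.2 ?_))
      exact max_lt haI.1 h
    · change ∫ t in 0..x, χ t = 0
      rw [← intervalIntegral.integral_add_adjacent_intervals (b := L)
        (hχ.continuous.intervalIntegrable _ _) (hχ.continuous.intervalIntegrable _ _), h0, zero_add,
        intervalIntegral.integral_congr (g := fun _ => 0), intervalIntegral.integral_zero]
      intro t ht
      exact hz t (Or.inr (lt_of_lt_of_le (lt_min hbI.2 h) ht.1))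
  refine ⟨fun x => ∫ t in 0..x, χ t, ?_, ?_, ?_, hderiv⟩
  · rw [contDiff_infty_iff_deriv]
    exact ⟨fun x => (hder x).differentiableAt, by rw [hderiv]; exact hχ⟩
  · exact HasCompactSupport.intro isCompact_Icc fun x hx =>
      image_eq_zero_of_notMem_tsupport (f := fun x => ∫ t in 0..x, χ t) fun h => hx (hsub h)
  · exact hsub.trans (Icc_subset_Ioo haI.1 hbI.2)

/-- The du Bois-Reymond lemma: a function with vanishing weak derivative is constant. -/
theorem exists_ae_eq_const_of_integral_mul_deriv_eq_zero {L : ℝ} (hL : 0 < L) {w : ℝ → ℝ}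
    (hw : IntervalIntegrable w volume 0 L)
    (h : ∀ φ : ℝ → ℝ, ContDiff ℝ ∞ φ → HasCompactSupport φ → tsupport φ ⊆ Ioo 0 L →
      ∫ x in 0..L, w x * deriv φ x = 0) :
    ∃ k, ∀ᵐ x ∂volume.restrict (Ioo 0 L), w x = k := by
  obtain ⟨φ₀, hφs, hφc, hφd, hφr, hφ1⟩ :=
    exists_contDiff_tsupport_subset (n := ⊤) (Ioo_mem_nhds (half_pos hL) (half_lt_self hL))
  have hI : 0 < ∫ x in 0..L, φ₀ x := by
    refine intervalIntegral.integral_pos hL hφd.continuous.continuousOn (fun x _ => ?_)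
      ⟨L / 2, ⟨by linarith, by linarith⟩, by rw [hφ1]; norm_num⟩
    exact (hφr (mem_range_self x)).1
  set I := ∫ x in 0..L, φ₀ x
  have hφd' : ContDiff ℝ ∞ φ₀ := hφd
  -- If `w` is constant, the constant must be its mean weighted by the bump `φ₀`.
  set k := (∫ x in 0..L, w x * φ₀ x) / I with hk
  refine ⟨k, ?_⟩
  have hwI : IntegrableOn w (Ioo 0 L) := by
    rwa [intervalIntegrable_iff_integrableOn_Ioo_of_le hL.le] at hw
  have hwk : IntegrableOn (fun x => w x - k) (Ioo 0 L) :=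
    hwI.sub (integrableOn_const (by simp))
  have := isOpen_Ioo.ae_eq_zero_of_integral_contDiff_smul_eq_zero
    (hwk.locallyIntegrableOn) (fun ψ hψ hψc hψs => ?_)
  · rw [ae_restrict_iff' measurableSet_Ioo]
    filter_upwards [this] with x hx hx'
    linarith [hx hx']
  set J := ∫ x in 0..L, ψ x with hJ
  have hsuppχ : tsupport (fun x => ψ x - J / I * φ₀ x) ⊆ tsupport ψ ∪ tsupport φ₀ := by
    refine closure_minimal ?_ ((isClosed_tsupport _).union (isClosed_tsupport _))
    intro x hx
    by_contra hn
    simp only [mem_union, not_or] at hn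
    apply hx
    simp [image_eq_zero_of_notMem_tsupport hn.1, image_eq_zero_of_notMem_tsupport hn.2]
  -- Subtracting the multiple of `φ₀` with the same integral turns `ψ` into the derivative of an
  -- admissible test function.
  obtain ⟨φ, h1, h2, h3, h4⟩ := exists_primitive_hasCompactSupport (L := L)
    (χ := fun x => ψ x - J / I * φ₀ x) (hψ.sub (contDiff_const.mul hφd'))
    ((hψc.isCompact.union hφc.isCompact).of_isClosed_subset (isClosed_tsupport _) hsuppχ)
    (hsuppχ.trans (union_subset hψs hφs)) (by
      rw [intervalIntegral.integral_sub (hψ.continuous.intervalIntegrable _ _)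
        ((hφd.continuous.intervalIntegrable _ _).const_mul _), intervalIntegral.integral_const_mul]
      change J - J / I * I = 0
      field_simp
      ring)
  have h5 := h φ h1 h2 h3
  rw [h4] at h5
  have e1 : ∫ x, ψ x • (w x - k) = ∫ x in 0..L, ψ x * (w x - k) := by
    rw [intervalIntegral_eq_setIntegral_Ioo hL.le]
    symm
    apply setIntegral_eq_integral_of_forall_compl_eq_zero
    intro x hx
    rw [eq_zero_of_tsupport_subset_Ioo hψs hx, zero_mul]
  have i1 : IntervalIntegrable (fun x => w x * ψ x) volume 0 L :=
    hw.mul_continuousOn hψ.continuous.continuousOn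
  have i2 : IntervalIntegrable (fun x => w x * φ₀ x) volume 0 L :=
    hw.mul_continuousOn hφd.continuous.continuousOn
  rw [e1]
  have e2 : ∫ x in 0..L, w x * (ψ x - J / I * φ₀ x)
      = (∫ x in 0..L, w x * ψ x) - J / I * ∫ x in 0..L, w x * φ₀ x := by
    rw [← intervalIntegral.integral_const_mul, ← intervalIntegral.integral_sub i1 (i2.const_mul _)]
    congr 1; ext x; ring
  have e3 : ∫ x in 0..L, ψ x * (w x - k) = (∫ x in 0..L, w x * ψ x) - k * J := by
    rw [hJ, ← intervalIntegral.integral_const_mul, ← intervalIntegral.integral_sub i1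
      ((hψ.continuous.intervalIntegrable _ _).const_mul _)]
    congr 1; ext x; ring
  rw [e3, hk]
  rw [e2] at h5
  refine Eq.trans ?_ h5
  field_simp

/-- Integration by parts against a test function. -/
theorem integral_primitive_mul_deriv {L : ℝ} (hL : 0 < L) {u g : ℝ → ℝ}
    (hg : IntervalIntegrable g volume 0 L)
    (hu : ∀ x ∈ Icc 0 L, u x = u 0 + ∫ t in 0..x, g t) {φ : ℝ → ℝ} (hφ : ContDiff ℝ ∞ φ)
    (hs : tsupport φ ⊆ Ioo 0 L) :
    ∫ x in 0..L, u x * deriv φ x = -∫ x in 0..L, g x * φ x := by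
  have hd : Continuous (deriv φ) := hφ.continuous_deriv (by simp)
  have huc : ContinuousOn u (uIcc 0 L) := by
    have := intervalIntegral.continuousOn_primitive_interval' hg (left_mem_uIcc)
    refine (this.const_add (u 0)).congr fun x hx => ?_
    rw [uIcc_of_le hL.le] at hx
    exact hu x hx
  have := integral_mul_add_mul_of_eq_add_integral hL.le hg (hd.intervalIntegrable _ _) hu
    (fun x _ => eq_add_integral_of_contDiff hφ x)
  rw [intervalIntegral.integral_add (hg.mul_continuousOn hφ.continuous.continuousOn)
    ((hd.intervalIntegrable _ _).continuousOn_mul huc),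
    eq_zero_of_tsupport_subset_Ioo hs (x := L) (by simp),
    eq_zero_of_tsupport_subset_Ioo hs (x := 0) (by simp)] at this
  linarith

/-- A function whose weak derivative is integrable is a.e. a primitive of its weak derivative. -/
theorem exists_ae_eq_add_integral_of_weak_deriv {L : ℝ} (hL : 0 < L) {u g : ℝ → ℝ}
    (hu : IntervalIntegrable u volume 0 L) (hg : IntervalIntegrable g volume 0 L)
    (h : ∀ φ : ℝ → ℝ, ContDiff ℝ ∞ φ → HasCompactSupport φ → tsupport φ ⊆ Ioo 0 L →
      ∫ x in 0..L, u x * deriv φ x = -∫ x in 0..L, g x * φ x) :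
    ∃ k, ∀ᵐ x ∂volume.restrict (Ioo 0 L), u x = k + ∫ t in 0..x, g t := by
  have hP : ContinuousOn (fun x => ∫ t in 0..x, g t) (uIcc 0 L) :=
    intervalIntegral.continuousOn_primitive_interval' hg (left_mem_uIcc)
  obtain ⟨k, hk⟩ := exists_ae_eq_const_of_integral_mul_deriv_eq_zero hL
    (w := fun x => u x - ∫ t in 0..x, g t) (hu.sub hP.intervalIntegrable) (fun φ h1 h2 h3 => by
      have hd : Continuous (deriv φ) := h1.continuous_deriv (by simp)
      have := integral_primitive_mul_deriv hL (u := fun x => ∫ t in 0..x, g t) hg (by simp) h1 h3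
      have e := h φ h1 h2 h3
      rw [← this, ← sub_eq_zero, ← intervalIntegral.integral_sub
        (hu.mul_continuousOn hd.continuousOn)
        ((hd.intervalIntegrable _ _).continuousOn_mul hP)] at e
      refine Eq.trans ?_ e
      congr 1; ext x; ring)
  exact ⟨k, hk.mono fun x hx => by linarith⟩

/-- The Sobolev functions on an interval are the primitives of square integrable functions. -/
theorem isSobolev_iff {L : ℝ} (hL : 0 < L) {u g : ℝ → ℝ} :
    IsSobolev L u g ↔ MemLp g 2 (volume.restrict (Ioo 0 L)) ∧
      ∀ x ∈ Icc 0 L, u x = u 0 + ∫ t in 0..x, g t := by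
  constructor
  · intro h
    refine ⟨h.memLp, ?_⟩
    have hg := h.memLp.intervalIntegrable_of_Ioo hL.le
    have hP : ContinuousOn (fun x => ∫ t in 0..x, g t) (uIcc 0 L) :=
      intervalIntegral.continuousOn_primitive_interval' hg (left_mem_uIcc)
    rw [uIcc_of_le hL.le] at hP
    obtain ⟨k, hk⟩ := exists_ae_eq_add_integral_of_weak_deriv hL
      (h.continuousOn.intervalIntegrable_of_Icc hL.le) hg h.weak_deriv
    -- Continuous functions equal almost everywhere on the interval agree at every point, endpoints
    -- included; evaluation at 0 then identifies `k`.
    have hEq : EqOn u (fun x => k + ∫ t in 0..x, g t) (Icc 0 L) := by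
      refine Measure.eqOn_Icc_of_ae_eq volume hL.ne ?_ h.continuousOn (hP.const_add k)
      rw [← restrict_Ioo_eq_restrict_Icc]
      exact hk
    intro x hx
    have h0 := hEq ⟨le_rfl, hL.le⟩
    simp only [intervalIntegral.integral_same, add_zero] at h0
    rw [h0]
    exact hEq hx
  · rintro ⟨h1, h2⟩
    have hg := h1.intervalIntegrable_of_Ioo hL.le
    refine ⟨?_, h1, fun φ ha _ hc => integral_primitive_mul_deriv hL hg h2 ha hc⟩
    have := intervalIntegral.continuousOn_primitive_interval' hg (left_mem_uIcc)
    rw [uIcc_of_le hL.le] at this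
    exact (this.const_add (u 0)).congr h2

/-- Cauchy–Schwarz against 1: the integral of (g - m)² is a nonnegative quadratic in m, so its
discriminant is nonpositive. -/
theorem sq_intervalIntegral_le {a b : ℝ} (hab : a ≤ b) {g : ℝ → ℝ}
    (hg : IntervalIntegrable g volume a b)
    (hg2 : IntervalIntegrable (fun x => g x ^ 2) volume a b) :
    (∫ x in a..b, g x) ^ 2 ≤ (b - a) * ∫ x in a..b, g x ^ 2 := by
  have h : ∀ m : ℝ, 0 ≤ (b - a) * (m * m) + (-2 * ∫ x in a..b, g x) * m
      + ∫ x in a..b, g x ^ 2 := by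
    intro m
    have h0 : 0 ≤ ∫ x in a..b, (g x - m) ^ 2 :=
      intervalIntegral.integral_nonneg hab fun x _ => sq_nonneg _
    have e : ∫ x in a..b, (g x - m) ^ 2
        = (∫ x in a..b, g x ^ 2) - 2 * m * (∫ x in a..b, g x) + (b - a) * m ^ 2 := by
      rw [← intervalIntegral.integral_const_mul, ← intervalIntegral.integral_sub hg2
        (hg.const_mul _), ← smul_eq_mul (b - a), ← intervalIntegral.integral_const,
        ← intervalIntegral.integral_add (hg2.sub (hg.const_mul _)) (by simp)]
      congr 1; ext x; ring
    rw [e] at h0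
    linarith
  have := discrim_le_zero h
  rw [discrim] at this
  nlinarith

/-! ### Square integrable and Sobolev families on a graph -/

namespace MetricGraph

variable {V E : Type*}

/-- The families of square integrable functions on the edges. -/
def IsL2 (Γ : MetricGraph V E) (g : E → ℝ → ℝ) : Prop :=
  ∀ e, MemLp (g e) 2 (volume.restrict (Ioo 0 (Γ.len e)))

variable {Γ : MetricGraph V E}

theorem IsL2.intervalIntegrable {g : E → ℝ → ℝ} (hg : Γ.IsL2 g) (e : E) :
    IntervalIntegrable (g e) volume 0 (Γ.len e) :=
  (hg e).intervalIntegrable_of_Ioo (Γ.len_pos e).le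

theorem IsL2.intervalIntegrable_mul {g h : E → ℝ → ℝ} (hg : Γ.IsL2 g) (hh : Γ.IsL2 h) (e : E) :
    IntervalIntegrable (fun x => g e x * h e x) volume 0 (Γ.len e) := by
  rw [intervalIntegrable_iff_integrableOn_Ioo_of_le (Γ.len_pos e).le]
  exact (hg e).integrable_mul (hh e)

theorem IsL2.intervalIntegrable_sq {g : E → ℝ → ℝ} (hg : Γ.IsL2 g) (e : E) :
    IntervalIntegrable (fun x => g e x ^ 2) volume 0 (Γ.len e) := by
  simpa only [sq] using hg.intervalIntegrable_mul hg e

/-- Sums, differences and multiples are all treated as instances of one two-term combination; this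
is why coefficients such as `1` and `(-1)` are written out in later statements. -/
theorem IsL2.lin {g h : E → ℝ → ℝ} (hg : Γ.IsL2 g) (hh : Γ.IsL2 h) (a b : ℝ) :
    Γ.IsL2 (fun e x => a * g e x + b * h e x) :=
  fun e => ((hg e).const_mul a).add ((hh e).const_mul b)

theorem isL2_of_continuousOn {u : E → ℝ → ℝ} (h : ∀ e, ContinuousOn (u e) (Icc 0 (Γ.len e))) :
    Γ.IsL2 u := by
  intro e
  obtain ⟨C, hC⟩ := isCompact_Icc.exists_bound_of_continuousOn (h e)
  refine MemLp.of_bound (((h e).mono Ioo_subset_Icc_self).aestronglyMeasurable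
    measurableSet_Ioo) C ?_
  rw [ae_restrict_iff' measurableSet_Ioo]
  exact ae_of_all _ fun x hx => hC x (Ioo_subset_Icc_self hx)

theorem IsW12.isL2 {u g : E → ℝ → ℝ} (h : Γ.IsW12 u g) : Γ.IsL2 u :=
  isL2_of_continuousOn fun e => (h e).continuousOn

theorem IsW12.isL2_deriv {u g : E → ℝ → ℝ} (h : Γ.IsW12 u g) : Γ.IsL2 g :=
  fun e => (h e).memLp

theorem IsW12.eq_add_integral {u g : E → ℝ → ℝ} (h : Γ.IsW12 u g) (e : E) {x : ℝ}
    (hx : x ∈ Icc 0 (Γ.len e)) : u e x = u e 0 + ∫ t in 0..x, g e t :=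
  ((isSobolev_iff (Γ.len_pos e)).1 (h e)).2 x hx

theorem isW12_of_eq_add_integral {u g : E → ℝ → ℝ} (hg : Γ.IsL2 g)
    (hu : ∀ e, ∀ x ∈ Icc 0 (Γ.len e), u e x = u e 0 + ∫ t in 0..x, g e t) : Γ.IsW12 u g :=
  fun e => (isSobolev_iff (Γ.len_pos e)).2 ⟨hg e, hu e⟩

theorem IsL2.intervalIntegrable_mono {g : E → ℝ → ℝ} (hg : Γ.IsL2 g) {e : E} {x y : ℝ}
    (hx : x ∈ Icc 0 (Γ.len e)) (hy : y ∈ Icc 0 (Γ.len e)) :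
    IntervalIntegrable (g e) volume x y :=
  (hg.intervalIntegrable e).mono_set (uIcc_subset_uIcc (by rwa [uIcc_of_le (Γ.len_pos e).le])
    (by rwa [uIcc_of_le (Γ.len_pos e).le]))

theorem IsW12.lin {u g w h : E → ℝ → ℝ} (hu : Γ.IsW12 u g) (hw : Γ.IsW12 w h) (a b : ℝ) :
    Γ.IsW12 (fun e x => a * u e x + b * w e x) (fun e x => a * g e x + b * h e x) := by
  refine isW12_of_eq_add_integral (hu.isL2_deriv.lin hw.isL2_deriv a b) fun e x hx => ?_
  have h0 : (0 : ℝ) ∈ Icc 0 (Γ.len e) := ⟨le_rfl, (Γ.len_pos e).le⟩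
  rw [intervalIntegral.integral_add ((hu.isL2_deriv.intervalIntegrable_mono h0 hx).const_mul _)
    ((hw.isL2_deriv.intervalIntegrable_mono h0 hx).const_mul _),
    intervalIntegral.integral_const_mul, intervalIntegral.integral_const_mul,
    hu.eq_add_integral e hx, hw.eq_add_integral e hx]
  ring

theorem isW12_const (c : ℝ) : Γ.IsW12 (fun _ _ => c) (fun _ _ => 0) :=
  isW12_of_eq_add_integral (fun _ => MemLp.zero) (by simp)

theorem continuousAtVertices_const (c : ℝ) : Γ.ContinuousAtVertices (fun _ _ => c) :=
  ⟨fun _ => c, fun _ => ⟨rfl, rfl⟩⟩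

theorem ContinuousAtVertices.lin {u w : E → ℝ → ℝ} (hu : Γ.ContinuousAtVertices u)
    (hw : Γ.ContinuousAtVertices w) (a b : ℝ) :
    Γ.ContinuousAtVertices (fun e x => a * u e x + b * w e x) := by
  obtain ⟨c, hc⟩ := hu
  obtain ⟨d, hd⟩ := hw
  exact ⟨fun v => a * c v + b * d v, fun e => by
    simp only [(hc e).1, (hc e).2, (hd e).1, (hd e).2, and_self]⟩

/-- The derivative may be changed on a null set. -/
theorem IsW12.congr {u g g' : E → ℝ → ℝ} (h : Γ.IsW12 u g)
    (hg : ∀ e, ∀ᵐ x ∂volume.restrict (Ioo 0 (Γ.len e)), g e x = g' e x) : Γ.IsW12 u g' := by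
  intro e
  refine ⟨(h e).continuousOn, (memLp_congr_ae (hg e)).1 (h e).memLp, fun φ h1 h2 h3 => ?_⟩
  rw [(h e).weak_deriv φ h1 h2 h3, intervalIntegral_eq_setIntegral_Ioo (Γ.len_pos e).le,
    intervalIntegral_eq_setIntegral_Ioo (Γ.len_pos e).le]
  congr 1
  refine integral_congr_ae ?_
  filter_upwards [hg e] with x hx
  rw [hx]

/-- Telescoping along the walk; the absolute value makes the orientation of the edges irrelevant. -/
theorem abs_sub_le_length_mul {c : V → ℝ} {δ : ℝ}
    (hc : ∀ e, |c (Γ.target e) - c (Γ.source e)| ≤ δ) {a b : V} (p : Γ.toSimpleGraph.Walk a b) :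
    |c a - c b| ≤ p.length * δ := by
  induction p with
  | nil => simp
  | @cons a b d hab p ih =>
    have h1 : |c a - c b| ≤ δ := by
      rw [toSimpleGraph, SimpleGraph.fromEdgeSet_adj] at hab
      obtain ⟨⟨e, he⟩, -⟩ := hab
      rcases Sym2.eq_iff.1 he with ⟨rfl, rfl⟩ | ⟨rfl, rfl⟩
      · rw [abs_sub_comm]; exact hc e
      · exact hc e
    have := abs_sub_le (c a) (c b) (c d)
    rw [SimpleGraph.Walk.length_cons]
    push_cast
    linarith

section Finite

variable [Fintype E]

theorem integral_lin {u w : E → ℝ → ℝ}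
    (hu : ∀ e, IntervalIntegrable (u e) volume 0 (Γ.len e))
    (hw : ∀ e, IntervalIntegrable (w e) volume 0 (Γ.len e)) (a b : ℝ) :
    Γ.integral (fun e x => a * u e x + b * w e x) = a * Γ.integral u + b * Γ.integral w := by
  simp only [integral, Finset.mul_sum, ← Finset.sum_add_distrib]
  refine Finset.sum_congr rfl fun e _ => ?_
  rw [intervalIntegral.integral_add ((hu e).const_mul _) ((hw e).const_mul _),
    intervalIntegral.integral_const_mul, intervalIntegral.integral_const_mul]

theorem integral_const (c : ℝ) : Γ.integral (fun _ _ => c) = c * ∑ e, Γ.len e := by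
  simp [integral, Finset.mul_sum, mul_comm]

theorem integral_mono {u w : E → ℝ → ℝ}
    (hu : ∀ e, IntervalIntegrable (u e) volume 0 (Γ.len e))
    (hw : ∀ e, IntervalIntegrable (w e) volume 0 (Γ.len e))
    (h : ∀ e, ∀ x ∈ Icc 0 (Γ.len e), u e x ≤ w e x) : Γ.integral u ≤ Γ.integral w :=
  Finset.sum_le_sum fun e _ => intervalIntegral.integral_mono_on (Γ.len_pos e).le (hu e) (hw e)
    (h e)

theorem integral_sq_nonneg (Γ : MetricGraph V E) (u : E → ℝ → ℝ) :
    0 ≤ Γ.integral (fun e x => u e x ^ 2) :=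
  Finset.sum_nonneg fun e _ =>
    intervalIntegral.integral_nonneg (Γ.len_pos e).le fun _ _ => sq_nonneg _

/-- Stands in for an inner product on the graph: the parallelogram identity, normalization,
Cauchy–Schwarz and the first variation are all read off from this expansion. -/
theorem integral_sq_lin {g h : E → ℝ → ℝ} (hg : Γ.IsL2 g) (hh : Γ.IsL2 h) (a b : ℝ) :
    Γ.integral (fun e x => (a * g e x + b * h e x) ^ 2)
      = a ^ 2 * Γ.integral (fun e x => g e x ^ 2)
        + 2 * a * b * Γ.integral (fun e x => g e x * h e x)
        + b ^ 2 * Γ.integral (fun e x => h e x ^ 2) := by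
  have e3 := integral_lin (fun e => hg.intervalIntegrable_sq e)
    (fun e => hg.intervalIntegrable_mul hh e) (a ^ 2) (2 * a * b)
  rw [← e3, ← one_mul (Γ.integral fun e x => a ^ 2 * g e x ^ 2 + 2 * a * b * (g e x * h e x)),
    ← integral_lin (fun e => ((hg.intervalIntegrable_sq e).const_mul _).add
      ((hg.intervalIntegrable_mul hh e).const_mul _)) (fun e => hh.intervalIntegrable_sq e)]
  congr 1; ext e x; ring

theorem sq_integral_mul_le {g h : E → ℝ → ℝ} (hg : Γ.IsL2 g) (hh : Γ.IsL2 h) :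
    Γ.integral (fun e x => g e x * h e x) ^ 2
      ≤ Γ.integral (fun e x => g e x ^ 2) * Γ.integral (fun e x => h e x ^ 2) := by
  have h0 : ∀ t : ℝ, 0 ≤ Γ.integral (fun e x => g e x ^ 2) * (t * t)
      + 2 * Γ.integral (fun e x => g e x * h e x) * t + Γ.integral (fun e x => h e x ^ 2) := by
    intro t
    have := integral_sq_lin hg hh t 1
    have h1 := Γ.integral_sq_nonneg (fun e x => t * g e x + 1 * h e x)
    simp only [this] at h1
    linarith
  have := discrim_le_zero h0
  rw [discrim] at this
  nlinarith

/-! ### Hölder and Poincaré bounds -/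

theorem integral_sq_edge_le (Γ : MetricGraph V E) (g : E → ℝ → ℝ) (e : E) :
    ∫ x in 0..Γ.len e, g e x ^ 2 ≤ Γ.integral (fun e x => g e x ^ 2) :=
  Finset.single_le_sum (f := fun e => ∫ x in 0..Γ.len e, g e x ^ 2)
    (fun e _ => intervalIntegral.integral_nonneg (Γ.len_pos e).le fun _ _ => sq_nonneg _)
    (Finset.mem_univ e)

/-- Cauchy–Schwarz on the subinterval; this is the source of the Hölder-1/2 modulus that drives
compactness. -/
theorem abs_integral_le_sqrt {g : E → ℝ → ℝ} (hg : Γ.IsL2 g) {e : E} {x y : ℝ}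
    (hx : x ∈ Icc 0 (Γ.len e)) (hy : y ∈ Icc 0 (Γ.len e)) :
    |∫ t in x..y, g e t| ≤ √|y - x| * √(Γ.integral (fun e x => g e x ^ 2)) := by
  wlog hxy : x ≤ y generalizing x y
  · rw [intervalIntegral.integral_symm, abs_neg, abs_sub_comm]
    exact this hy hx (le_of_not_ge hxy)
  have hsub : uIcc x y ⊆ uIcc 0 (Γ.len e) :=
    uIcc_subset_uIcc (by rwa [uIcc_of_le (Γ.len_pos e).le])
      (by rwa [uIcc_of_le (Γ.len_pos e).le])
  rw [← Real.sqrt_mul (abs_nonneg _)]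
  apply Real.abs_le_sqrt
  rw [abs_of_nonneg (sub_nonneg.2 hxy)]
  refine (sq_intervalIntegral_le hxy (hg.intervalIntegrable_mono hx hy)
    ((hg.intervalIntegrable_sq e).mono_set hsub)).trans ?_
  refine mul_le_mul_of_nonneg_left ?_ (sub_nonneg.2 hxy)
  refine le_trans ?_ (Γ.integral_sq_edge_le g e)
  exact intervalIntegral.integral_mono_interval hx.1 hxy hy.2
    (ae_of_all _ fun x => sq_nonneg _) (hg.intervalIntegrable_sq e)

theorem IsW12.abs_sub_le {u g : E → ℝ → ℝ} (h : Γ.IsW12 u g) {e : E} {x y : ℝ}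
    (hx : x ∈ Icc 0 (Γ.len e)) (hy : y ∈ Icc 0 (Γ.len e)) :
    |u e y - u e x| ≤ √|y - x| * √(Γ.integral (fun e x => g e x ^ 2)) := by
  have h0 : (0 : ℝ) ∈ Icc 0 (Γ.len e) := ⟨le_rfl, (Γ.len_pos e).le⟩
  rw [h.eq_add_integral e hx, h.eq_add_integral e hy, add_sub_add_left_eq_sub,
    intervalIntegral.integral_interval_sub_left (h.isL2_deriv.intervalIntegrable_mono h0 hy)
      (h.isL2_deriv.intervalIntegrable_mono h0 hx)]
  exact abs_integral_le_sqrt h.isL2_deriv hx hy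

/-- On a connected compact graph the oscillation of a function is controlled by the norm of its
derivative. -/
theorem exists_osc_bound [Finite V] (hΓ : Γ.toSimpleGraph.Connected) :
    ∃ C : ℝ, 0 ≤ C ∧ ∀ u g : E → ℝ → ℝ, Γ.IsW12 u g → Γ.ContinuousAtVertices u →
      ∀ e, ∀ x ∈ Icc 0 (Γ.len e), ∀ e', ∀ y ∈ Icc 0 (Γ.len e'),
        |u e x - u e' y| ≤ C * √(Γ.integral (fun e x => g e x ^ 2)) := by
  obtain ⟨N, hN⟩ := (Set.finite_range fun p : V × V => Γ.toSimpleGraph.dist p.1 p.2).bddAbove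
  set K := ∑ e, √(Γ.len e)
  have hK : 0 ≤ K := Finset.sum_nonneg fun e _ => Real.sqrt_nonneg _
  -- Each full or partial edge costs at most `K * S`: two partial edges at the ends, and at most `N`
  -- whole edges between their sources, `N` bounding all graph distances.
  refine ⟨(2 + N) * K, by positivity, fun u g hu ⟨c, hc⟩ e x hx e' y hy => ?_⟩
  set S := √(Γ.integral (fun e x => g e x ^ 2))
  have hS : 0 ≤ S := Real.sqrt_nonneg _
  have hedge : ∀ e, ∀ x ∈ Icc 0 (Γ.len e), ∀ y ∈ Icc 0 (Γ.len e), |u e y - u e x| ≤ K * S := by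
    intro e x hx y hy
    refine (hu.abs_sub_le hx hy).trans (mul_le_mul_of_nonneg_right ?_ hS)
    refine le_trans (Real.sqrt_le_sqrt ?_) (Finset.single_le_sum (f := fun e => √(Γ.len e))
      (fun e _ => Real.sqrt_nonneg _) (Finset.mem_univ e))
    rw [abs_le]; constructor <;> linarith [hx.1, hx.2, hy.1, hy.2]
  have h0 : ∀ e, (0 : ℝ) ∈ Icc 0 (Γ.len e) := fun e => ⟨le_rfl, (Γ.len_pos e).le⟩
  have h1 : ∀ e, Γ.len e ∈ Icc 0 (Γ.len e) := fun e => ⟨(Γ.len_pos e).le, le_rfl⟩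
  obtain ⟨p, hp⟩ := hΓ.exists_walk_length_eq_dist (Γ.source e) (Γ.source e')
  have hw := abs_sub_le_length_mul (c := c) (δ := K * S) (fun e => by
    rw [← (hc e).1, ← (hc e).2]; exact hedge e _ (h0 e) _ (h1 e)) p
  have hpN : (p.length : ℝ) ≤ N := by
    rw [hp]; exact_mod_cast hN ⟨(Γ.source e, Γ.source e'), rfl⟩
  rw [← (hc e).1, ← (hc e').1] at hw
  have a1 := hedge e _ (h0 e) _ hx
  have a2 := hedge e' _ hy _ (h0 e')
  have hKS : 0 ≤ K * S := mul_nonneg hK hS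
  calc |u e x - u e' y| = |(u e x - u e 0) + (u e 0 - u e' 0) + (u e' 0 - u e' y)| := by ring_nf
    _ ≤ |u e x - u e 0| + |u e 0 - u e' 0| + |u e' 0 - u e' y| := abs_add_three _ _ _
    _ ≤ K * S + N * (K * S) + K * S := by
        refine add_le_add (add_le_add a1 (hw.trans ?_)) a2
        exact mul_le_mul_of_nonneg_right hpN hKS
    _ = _ := by ring

theorem sum_len_pos [Nonempty E] (Γ : MetricGraph V E) : 0 < ∑ e, Γ.len e :=
  Finset.sum_pos (fun e _ => Γ.len_pos e) Finset.univ_nonempty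

/-- A uniform Poincaré inequality. -/
theorem exists_sup_bound [Finite V] [Nonempty E] (hΓ : Γ.toSimpleGraph.Connected) :
    ∃ C : ℝ, 0 ≤ C ∧ ∀ u g : E → ℝ → ℝ, Γ.IsW12 u g → Γ.ContinuousAtVertices u →
      Γ.integral u = 0 → ∀ e, ∀ x ∈ Icc 0 (Γ.len e),
        |u e x| ≤ C * √(Γ.integral (fun e x => g e x ^ 2)) := by
  obtain ⟨C, hC, h⟩ := exists_osc_bound hΓ
  refine ⟨C, hC, fun u g hu hv h0 e x hx => ?_⟩
  set B := C * √(Γ.integral (fun e x => g e x ^ 2))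
  have hlen := Γ.sum_len_pos
  have hi := hu.isL2.intervalIntegrable
  -- Fix one point and integrate the oscillation bound over the other one; the mean of the other
  -- value is zero.
  have b := h u g hu hv e x hx
  rw [abs_le]
  constructor
  · have := integral_mono hi (w := fun _ _ => u e x + B) (by simp) (fun e' y hy => by
      linarith [(abs_le.1 (b e' y hy)).1])
    rw [h0, integral_const] at this
    linarith [nonneg_of_mul_nonneg_left this hlen]
  · have := integral_mono (u := fun _ _ => u e x - B) (by simp) hi (fun e' y hy => by
      linarith [(abs_le.1 (b e' y hy)).2])
    rw [h0, integral_const] at this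
    linarith [nonpos_of_mul_nonpos_left this hlen]

end Finite

end MetricGraph

/-! ### Compactness and existence of a minimizer -/

theorem norm_toLp_sq {α : Type*} [MeasurableSpace α] {μ : Measure α} {f : α → ℝ}
    (hf : MemLp f 2 μ) : ‖hf.toLp f‖ ^ 2 = ∫ x, f x ^ 2 ∂μ := by
  rw [← real_inner_self_eq_norm_sq, L2.inner_def]
  refine integral_congr_ae ?_
  filter_upwards [hf.coeFn_toLp] with x hx
  rw [hx, real_inner_self_eq_norm_sq, Real.norm_eq_abs, sq_abs]

/-- Arzelà–Ascoli. The common modulus gives equicontinuity, and it also forces continuity of any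
function satisfying the bounds, so the set is closed inside a compact cube for pointwise
convergence. -/
theorem isCompact_setOf_holder_half (L M B : ℝ) :
    IsCompact {f : C(Icc 0 L, ℝ) | (∀ x, |f x| ≤ M) ∧
      ∀ x y : Icc 0 L, |f x - f y| ≤ √|(x : ℝ) - y| * B} := by
  have hlim : Tendsto (fun t : ℝ => √t * B) (𝓝 0) (𝓝 0) := by
    have : Continuous fun t : ℝ => √t * B := by fun_prop
    simpa using this.tendsto 0
  apply ArzelaAscoli.isCompact_of_equicontinuous
  · have himg : ContinuousMap.toFun '' {f : C(Icc 0 L, ℝ) | (∀ x, |f x| ≤ M) ∧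
        ∀ x y : Icc 0 L, |f x - f y| ≤ √|(x : ℝ) - y| * B}
        = {f : Icc 0 L → ℝ | (∀ x, |f x| ≤ M) ∧
          ∀ x y : Icc 0 L, |f x - f y| ≤ √|(x : ℝ) - y| * B} := by
      ext f
      constructor
      · rintro ⟨f, hf, rfl⟩
        exact hf
      · intro hf
        refine ⟨⟨f, ?_⟩, hf, rfl⟩
        rw [continuous_iff_continuousAt]
        intro x
        rw [ContinuousAt, tendsto_iff_dist_tendsto_zero]
        have h1 : Tendsto (fun y : Icc 0 L => dist y x) (𝓝 x) (𝓝 0) := by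
          rw [← tendsto_iff_dist_tendsto_zero]; exact tendsto_id
        exact squeeze_zero (fun _ => dist_nonneg) (fun y => hf.2 y x) (hlim.comp h1)
    rw [himg]
    refine (isCompact_univ_pi fun _ => isCompact_Icc (a := -M) (b := M)).of_isClosed_subset ?_ ?_
    · simp only [ofPred_and, ofPred_forall]
      refine (isClosed_iInter fun x => ?_).inter
        (isClosed_iInter fun x => isClosed_iInter fun y => ?_)
      · exact isClosed_le (by fun_prop) continuous_const
      · exact isClosed_le (by fun_prop) continuous_const
    · exact fun f hf x _ => abs_le.1 (hf.1 x)
  · exact (Metric.uniformEquicontinuous_of_continuity_modulus _ hlim _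
      fun x y f => f.2.2 x y).equicontinuous

namespace MetricGraph

variable {V E : Type*} {Γ : MetricGraph V E}

theorem isW12_of_hasDerivAt {u g : E → ℝ → ℝ} (hg : ∀ e, Continuous (g e))
    (hu : ∀ e x, HasDerivAt (u e) (g e x) x) : Γ.IsW12 u g := by
  refine isW12_of_eq_add_integral (isL2_of_continuousOn fun e => (hg e).continuousOn)
    fun e x _ => ?_
  rw [intervalIntegral.integral_eq_sub_of_hasDerivAt (fun y _ => hu e y)
    ((hg e).intervalIntegrable _ _)]
  ring

/-- Continuity at the vertices is preserved by pointwise limits. -/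
theorem ContinuousAtVertices.of_tendsto [Finite V] {u : ℕ → E → ℝ → ℝ} {U : E → ℝ → ℝ}
    (hu : ∀ n, Γ.ContinuousAtVertices (u n))
    (h : ∀ e, ∀ x ∈ Icc 0 (Γ.len e), Tendsto (fun n => u n e x) atTop (𝓝 (U e x))) :
    Γ.ContinuousAtVertices U := by
  -- The endpoint values compatible with continuity form the range of a linear map from a
  -- finite-dimensional space, hence a closed set; no convergence of the vertex values themselves
  -- has to be shown.
  let T : (V → ℝ) →ₗ[ℝ] (E → ℝ) × (E → ℝ) :=
    (LinearMap.funLeft ℝ ℝ Γ.source).prod (LinearMap.funLeft ℝ ℝ Γ.target)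
  have hT : IsClosed (LinearMap.range T : Set ((E → ℝ) × (E → ℝ))) :=
    Submodule.closed_of_finiteDimensional _
  have h0 : ∀ e, (0 : ℝ) ∈ Icc 0 (Γ.len e) := fun e => ⟨le_rfl, (Γ.len_pos e).le⟩
  have h1 : ∀ e, Γ.len e ∈ Icc 0 (Γ.len e) := fun e => ⟨(Γ.len_pos e).le, le_rfl⟩
  have hlim : Tendsto (fun n => ((fun e => u n e 0, fun e => u n e (Γ.len e)) :
      (E → ℝ) × (E → ℝ))) atTop (𝓝 (fun e => U e 0, fun e => U e (Γ.len e))) :=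
    (tendsto_pi_nhds.2 fun e => h e 0 (h0 e)).prodMk_nhds
      (tendsto_pi_nhds.2 fun e => h e _ (h1 e))
  obtain ⟨c, hc⟩ := hT.mem_of_tendsto hlim (Eventually.of_forall fun n => by
    obtain ⟨c, hc⟩ := hu n
    refine ⟨c, ?_⟩
    ext e
    · exact (hc e).1.symm
    · exact (hc e).2.symm)
  refine ⟨c, fun e => ⟨?_, ?_⟩⟩
  · exact (congrFun (congrArg Prod.fst hc) e).symm
  · exact (congrFun (congrArg Prod.snd hc) e).symm

section Finite

variable [Fintype E]

theorem integral_sq_eq_sum_norm_sq {g : E → ℝ → ℝ} (hg : Γ.IsL2 g) :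
    Γ.integral (fun e x => g e x ^ 2) = ∑ e, ‖(hg e).toLp (g e)‖ ^ 2 := by
  refine Finset.sum_congr rfl fun e _ => ?_
  rw [norm_toLp_sq, intervalIntegral_eq_setIntegral_Ioo (Γ.len_pos e).le]

theorem tendsto_integral_of_bounded {f : ℕ → E → ℝ → ℝ} {F : E → ℝ → ℝ} {B : ℝ}
    (hf : ∀ n e, ContinuousOn (f n e) (Icc 0 (Γ.len e)))
    (hB : ∀ n e, ∀ x ∈ Icc 0 (Γ.len e), |f n e x| ≤ B)
    (h : ∀ e, ∀ x ∈ Icc 0 (Γ.len e), Tendsto (fun n => f n e x) atTop (𝓝 (F e x))) :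
    Tendsto (fun n => Γ.integral (f n)) atTop (𝓝 (Γ.integral F)) := by
  refine tendsto_finsetSum _ fun e _ => ?_
  have hI : uIoc 0 (Γ.len e) ⊆ Icc 0 (Γ.len e) := by
    rw [uIoc_of_le (Γ.len_pos e).le]; exact Ioc_subset_Icc_self
  refine intervalIntegral.tendsto_integral_filter_of_dominated_convergence (fun _ => B)
    (Eventually.of_forall fun n => ?_) (Eventually.of_forall fun n => ?_) (by simp) ?_
  · exact ((hf n e).mono hI).aestronglyMeasurable measurableSet_uIoc
  · exact ae_of_all _ fun x hx => hB n e x (hI hx)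
  · exact ae_of_all _ fun x hx => h e x (hI hx)

/-- Bounded sequences in `W^{1,2}` have pointwise convergent subsequences. -/
theorem exists_tendsto_subseq {u g : ℕ → E → ℝ → ℝ} {M B : ℝ} (hu : ∀ n, Γ.IsW12 (u n) (g n))
    (hM : ∀ n e, ∀ x ∈ Icc 0 (Γ.len e), |u n e x| ≤ M)
    (hB : ∀ n, √(Γ.integral (fun e x => g n e x ^ 2)) ≤ B) :
    ∃ (φ : ℕ → ℕ) (U : E → ℝ → ℝ), StrictMono φ ∧ (∀ e, ContinuousOn (U e) (Icc 0 (Γ.len e))) ∧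
      ∀ e, ∀ x ∈ Icc 0 (Γ.len e), Tendsto (fun n => u (φ n) e x) atTop (𝓝 (U e x)) := by
  let f : ℕ → ∀ e, C(Icc 0 (Γ.len e), ℝ) := fun n e =>
    ⟨(Icc 0 (Γ.len e)).domRestrict (u n e), (hu n e).continuousOn.domRestrict⟩
  have hK := isCompact_univ_pi fun e => isCompact_setOf_holder_half (Γ.len e) M B
  obtain ⟨F, -, φ, hφ, hF⟩ := hK.tendsto_subseq (x := f) (fun n e _ =>
    ⟨fun x => hM n e x x.2, fun x y => ((hu n).abs_sub_le y.2 x.2).trans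
      (mul_le_mul_of_nonneg_left (hB n) (Real.sqrt_nonneg _))⟩)
  refine ⟨φ, fun e => IccExtend (Γ.len_pos e).le (F e), hφ, fun e => ?_, fun e x hx => ?_⟩
  · exact (F e).continuous.Icc_extend'.continuousOn
  · change Tendsto _ _ (𝓝 (IccExtend _ (F e) x))
    rw [IccExtend_of_mem _ _ hx]
    have h1 := (tendsto_pi_nhds.1 hF) e
    have h2 := ((continuous_eval_const (F := C(Icc 0 (Γ.len e), ℝ)) (⟨x, hx⟩ : Icc 0 (Γ.len e))).tendsto
      (F e)).comp h1
    exact h2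

/-- Completeness of the space of square integrable functions. -/
theorem exists_tendsto_of_integral_sub_sq_le {g : ℕ → E → ℝ → ℝ} (hg : ∀ n, Γ.IsL2 (g n))
    {δ : ℕ → ℝ} (hδ : Tendsto δ atTop (𝓝 0))
    (h : ∀ n m, Γ.integral (fun e x => (1 * g n e x + (-1) * g m e x) ^ 2) ≤ δ n + δ m) :
    ∃ G : E → ℝ → ℝ, Γ.IsL2 G ∧
      Tendsto (fun n => Γ.integral (fun e x => (1 * g n e x + (-1) * G e x) ^ 2)) atTop (𝓝 0) ∧
      Tendsto (fun n => Γ.integral (fun e x => g n e x ^ 2)) atTop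
        (𝓝 (Γ.integral (fun e x => G e x ^ 2))) := by
  have hsub : ∀ {a b : ℝ → ℝ} {e : E} (ha : MemLp a 2 (volume.restrict (Ioo 0 (Γ.len e))))
      (hb : MemLp b 2 (volume.restrict (Ioo 0 (Γ.len e)))),
      ‖ha.toLp a - hb.toLp b‖ ^ 2 = ∫ x in 0..Γ.len e, (1 * a x + (-1) * b x) ^ 2 := by
    intro a b e ha hb
    rw [← MemLp.toLp_sub, norm_toLp_sq, intervalIntegral_eq_setIntegral_Ioo (Γ.len_pos e).le]
    congr 1; ext x; simp only [Pi.sub_apply]; ring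
  have hC : ∀ e, CauchySeq fun n => (hg n e).toLp (g n e) := by
    intro e
    rw [Metric.cauchySeq_iff]
    intro ε hε
    have : ∀ᶠ n in atTop, δ n < ε ^ 2 / 2 := hδ.eventually_lt_const (by positivity)
    obtain ⟨N, hN⟩ := eventually_atTop.1 this
    refine ⟨N, fun n hn m hm => ?_⟩
    rw [dist_eq_norm]
    refine lt_of_pow_lt_pow_left₀ 2 hε.le ?_
    rw [hsub]
    have h1 := Γ.integral_sq_edge_le (fun e x => 1 * g n e x + (-1) * g m e x) e
    have h2 := h n m
    have h3 := hN n hn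
    have h4 := hN m hm
    linarith
  choose F hF using fun e => cauchySeq_tendsto_of_complete (hC e)
  have hG : Γ.IsL2 (fun e => F e) := fun e => Lp.memLp (F e)
  refine ⟨fun e => F e, hG, ?_, ?_⟩
  · have : ∀ n, Γ.integral (fun e x => (1 * g n e x + (-1) * F e x) ^ 2)
        = ∑ e, ‖(hg n e).toLp (g n e) - F e‖ ^ 2 := by
      intro n
      refine Finset.sum_congr rfl fun e _ => ?_
      rw [← hsub (hg n e) (hG e), Lp.toLp_coeFn]
    simp only [this]
    have h1 := tendsto_finsetSum Finset.univ
      fun e _ => (tendsto_iff_norm_sub_tendsto_zero.1 (hF e)).pow 2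
    simpa using h1
  · rw [integral_sq_eq_sum_norm_sq hG]
    simp only [fun n => integral_sq_eq_sum_norm_sq (hg n)]
    refine tendsto_finsetSum _ fun e _ => ?_
    rw [Lp.toLp_coeFn]
    exact (hF e).norm.pow 2

theorem rayleighQuotients_nonneg {r : ℝ} (hr : r ∈ Γ.rayleighQuotients) : 0 ≤ r := by
  obtain ⟨u, g, -, -, -, -, rfl⟩ := hr
  exact div_nonneg (Γ.integral_sq_nonneg g) (Γ.integral_sq_nonneg u)

theorem bddBelow_rayleighQuotients : BddBelow Γ.rayleighQuotients :=
  ⟨0, fun _ hr => rayleighQuotients_nonneg hr⟩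

/-- Without this the real `sInf` could be the default value 0 of an empty set. -/
theorem rayleighQuotients_nonempty [Nonempty E] (Γ : MetricGraph V E) :
    Γ.rayleighQuotients.Nonempty := by
  classical
  obtain ⟨e₀⟩ := ‹Nonempty E›
  set L := Γ.len e₀
  have hL : 0 < L := Γ.len_pos e₀
  -- On one edge, the derivative of (x(L - x))²/2: it vanishes at both ends, so it extends by zero
  -- continuously, and its primitive vanishes there too, so its mean is zero.
  let u : E → ℝ → ℝ := fun e x => if e = e₀ then x * (L - x) * (L - 2 * x) else 0
  let g : E → ℝ → ℝ := fun e x => if e = e₀ then L ^ 2 - 6 * L * x + 6 * x ^ 2 else 0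
  have hsum : ∀ f : ℝ → ℝ, Γ.integral (fun e x => if e = e₀ then f x else 0)
      = ∫ x in 0..L, f x := by
    intro f
    rw [integral, Finset.sum_eq_single e₀]
    · simp [L]
    · intro e _ he; simp [he]
    · simp
  refine ⟨_, u, g, isW12_of_hasDerivAt (fun e => ?_) (fun e x => ?_), ⟨0, fun e => ?_⟩, ?_, ?_,
    rfl⟩
  · by_cases he : e = e₀ <;> simp only [g, he, if_true, if_false] <;> fun_prop
  · by_cases he : e = e₀
    · simp only [u, g, he, if_true]
      have h := (((hasDerivAt_id x).mul ((hasDerivAt_id x).const_sub L))).mul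
        (((hasDerivAt_id x).const_mul 2).const_sub L)
      convert! h using 1
      simp only [id, Pi.mul_apply]; ring
    · simp only [u, g, he, if_false]; exact hasDerivAt_const x 0
  · by_cases he : e = e₀
    · subst he; simp [u, L]
    · simp [u, he]
  · have : (fun e x => u e x ^ 2)
        = fun e x => if e = e₀ then (x * (L - x) * (L - 2 * x)) ^ 2 else 0 := by
      ext e x; by_cases he : e = e₀ <;> simp [u, he]
    rw [this, hsum]
    refine (intervalIntegral.integral_pos hL (by fun_prop) (fun x _ => sq_nonneg _)
      ⟨L / 4, ⟨by linarith, by linarith⟩, ?_⟩).ne'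
    have : L / 4 * (L - L / 4) * (L - 2 * (L / 4)) = 3 / 32 * L ^ 3 := by ring
    rw [this]; positivity
  · rw [hsum, intervalIntegral.integral_eq_sub_of_hasDerivAt
      (f := fun x => (x * (L - x)) ^ 2 / 2) (fun x _ => ?_)
      (Continuous.intervalIntegrable (by fun_prop) _ _)]
    · simp
    · have h := (((hasDerivAt_id x).mul ((hasDerivAt_id x).const_sub L)).pow 2).div_const 2
      convert! h using 1
      simp only [id, Pi.mul_apply]; norm_num; ring

theorem exists_normalized_of_mem_rayleighQuotients {r : ℝ} (hr : r ∈ Γ.rayleighQuotients) :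
    ∃ u g : E → ℝ → ℝ, Γ.IsW12 u g ∧ Γ.ContinuousAtVertices u ∧
      Γ.integral (fun e x => u e x ^ 2) = 1 ∧ Γ.integral u = 0 ∧
      Γ.integral (fun e x => g e x ^ 2) = r := by
  obtain ⟨u, g, hu, hc, h0, hm, rfl⟩ := hr
  have hpos := lt_of_le_of_ne (Γ.integral_sq_nonneg u) h0.symm
  set N := Γ.integral (fun e x => u e x ^ 2)
  have hN : (1 / √N) ^ 2 = 1 / N := by rw [div_pow, Real.sq_sqrt hpos.le]; simp
  refine ⟨_, _, hu.lin hu (1 / √N) 0, hc.lin hc (1 / √N) 0, ?_, ?_, ?_⟩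
  · rw [integral_sq_lin hu.isL2 hu.isL2, hN]
    change 1 / N * N + _ + _ = 1
    field_simp
    ring
  · rw [integral_lin hu.isL2.intervalIntegrable hu.isL2.intervalIntegrable, hm]; ring
  · rw [integral_sq_lin hu.isL2_deriv hu.isL2_deriv, hN]; ring

/-- In this product form the bound also covers functions of zero norm, so it applies to sums and
perturbations without checking that they are nonzero. -/
theorem sInf_rayleighQuotients_mul_le {u g : E → ℝ → ℝ} (hu : Γ.IsW12 u g)
    (hc : Γ.ContinuousAtVertices u) (hm : Γ.integral u = 0) :
    sInf Γ.rayleighQuotients * Γ.integral (fun e x => u e x ^ 2)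
      ≤ Γ.integral (fun e x => g e x ^ 2) := by
  by_cases h0 : Γ.integral (fun e x => u e x ^ 2) = 0
  · rw [h0, mul_zero]; exact Γ.integral_sq_nonneg g
  · have hpos := lt_of_le_of_ne (Γ.integral_sq_nonneg u) (Ne.symm h0)
    rw [← le_div_iff₀ hpos]
    exact csInf_le bddBelow_rayleighQuotients ⟨u, g, hu, hc, h0, hm, rfl⟩

/-- The Rayleigh quotient attains its minimum. -/
theorem exists_minimizer [Finite V] [Nonempty E] (hΓ : Γ.toSimpleGraph.Connected) :
    ∃ u g : E → ℝ → ℝ, Γ.IsW12 u g ∧ Γ.ContinuousAtVertices u ∧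
      Γ.integral (fun e x => u e x ^ 2) = 1 ∧ Γ.integral u = 0 ∧
      Γ.integral (fun e x => g e x ^ 2) = sInf Γ.rayleighQuotients := by
  set lam := sInf Γ.rayleighQuotients with hlam
  have hlam0 : 0 ≤ lam := Real.sInf_nonneg fun _ hr => rayleighQuotients_nonneg hr
  obtain ⟨r, -, hr, hrS⟩ :=
    exists_seq_tendsto_sInf Γ.rayleighQuotients_nonempty (bddBelow_rayleighQuotients (Γ := Γ))
  rw [← hlam] at hr
  choose u g hu hc h1 hm hg using fun n => exists_normalized_of_mem_rayleighQuotients (hrS n)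
  obtain ⟨R, hR⟩ := hr.bddAbove_range
  obtain ⟨C, hC, hCb⟩ := exists_sup_bound hΓ
  have hB : ∀ n, √(Γ.integral (fun e x => g n e x ^ 2)) ≤ √R := fun n =>
    Real.sqrt_le_sqrt (by rw [hg n]; exact hR ⟨n, rfl⟩)
  have hM : ∀ n e, ∀ x ∈ Icc 0 (Γ.len e), |u n e x| ≤ C * √R := fun n e x hx =>
    (hCb _ _ (hu n) (hc n) (hm n) e x hx).trans (mul_le_mul_of_nonneg_left (hB n) hC)
  obtain ⟨φ, U, hφ, hUc, hU⟩ := exists_tendsto_subseq hu hM hB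
  have hUL : Γ.IsL2 U := isL2_of_continuousOn hUc
  have hUM : ∀ e, ∀ x ∈ Icc 0 (Γ.len e), |U e x| ≤ C * √R := fun e x hx =>
    le_of_tendsto (hU e x hx).abs (Eventually.of_forall fun n => hM _ e x hx)
  have hrφ := hr.comp hφ.tendsto_atTop
  have hd : Tendsto (fun n => Γ.integral (fun e x => (1 * u (φ n) e x + (-1) * U e x) ^ 2)) atTop
      (𝓝 0) := by
    have := tendsto_integral_of_bounded (Γ := Γ)
      (f := fun n e x => (1 * u (φ n) e x + (-1) * U e x) ^ 2) (F := fun _ _ => 0)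
      (B := (2 * (C * √R)) ^ 2)
      (fun n e => ((((hu (φ n) e).continuousOn).const_mul 1).add ((hUc e).const_mul (-1))).pow 2)
      (fun n e x hx => by
        rw [abs_pow]
        refine pow_le_pow_left₀ (abs_nonneg _) ?_ 2
        have a1 := abs_le.1 (hM (φ n) e x hx)
        have a2 := abs_le.1 (hUM e x hx)
        rw [abs_le]; constructor <;> linarith) (fun e x hx => by
        have := (((hU e x hx).const_mul 1).add
          ((tendsto_const_nhds (x := U e x)).const_mul (-1))).pow 2
        simpa using this)
    simpa [integral_const] using this
  -- With norms in L², ‖g_n - g_m‖² = 2r_n + 2r_m - ‖g_n + g_m‖² and ‖g_n + g_m‖² ≥ λ‖u_n + u_m‖² =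
  -- λ(4 - ‖u_n - u_m‖²). Comparing u_n and u_m with the limit `U` splits the error into a term in n
  -- plus a term in m.
  have hcauchy : ∀ n m, Γ.integral (fun e x => (1 * g (φ n) e x + (-1) * g (φ m) e x) ^ 2)
      ≤ (2 * (r (φ n) - lam) + 2 * lam * Γ.integral
          (fun e x => (1 * u (φ n) e x + (-1) * U e x) ^ 2))
        + (2 * (r (φ m) - lam) + 2 * lam * Γ.integral
          (fun e x => (1 * u (φ m) e x + (-1) * U e x) ^ 2)) := by
    intro n m
    have hun := hu (φ n)
    have hum := hu (φ m)
    have b1 := sInf_rayleighQuotients_mul_le (hun.lin hum 1 1) ((hc (φ n)).lin (hc (φ m)) 1 1)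
      (by rw [integral_lin hun.isL2.intervalIntegrable hum.isL2.intervalIntegrable, hm, hm]; ring)
    have b2 := Γ.integral_sq_nonneg (fun e x => 1 * (1 * u (φ n) e x + (-1) * U e x)
      + 1 * (1 * u (φ m) e x + (-1) * U e x))
    rw [integral_sq_lin (hun.isL2.lin hUL 1 (-1)) (hum.isL2.lin hUL 1 (-1))] at b2
    have b3 : Γ.integral (fun e x => (1 * u (φ n) e x + (-1) * u (φ m) e x) ^ 2)
        = Γ.integral (fun e x => (1 * (1 * u (φ n) e x + (-1) * U e x)
          + (-1) * (1 * u (φ m) e x + (-1) * U e x)) ^ 2) := by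
      congr 1; ext e x; ring
    rw [integral_sq_lin (hun.isL2.lin hUL 1 (-1)) (hum.isL2.lin hUL 1 (-1)),
      integral_sq_lin hun.isL2 hum.isL2, h1, h1] at b3
    rw [integral_sq_lin hun.isL2 hum.isL2, integral_sq_lin hun.isL2_deriv hum.isL2_deriv,
      h1, h1, hg, hg, ← hlam] at b1
    rw [integral_sq_lin hun.isL2_deriv hum.isL2_deriv, hg, hg]
    have b4 : 4 - 2 * Γ.integral (fun e x => (1 * u (φ n) e x + (-1) * U e x) ^ 2)
        - 2 * Γ.integral (fun e x => (1 * u (φ m) e x + (-1) * U e x) ^ 2)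
        ≤ 2 + 2 * Γ.integral (fun e x => u (φ n) e x * u (φ m) e x) := by linarith
    have b5 := mul_le_mul_of_nonneg_left b4 hlam0
    linarith
  obtain ⟨G, hG, hG0, hG1⟩ := exists_tendsto_of_integral_sub_sq_le
    (fun n => (hu (φ n)).isL2_deriv)
    (δ := fun n => 2 * (r (φ n) - lam) + 2 * lam * Γ.integral
          (fun e x => (1 * u (φ n) e x + (-1) * U e x) ^ 2))
    (by simpa using ((hrφ.sub_const lam).const_mul 2).add (hd.const_mul (2 * lam))) hcauchy
  have hUW : Γ.IsW12 U G := by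
    refine isW12_of_eq_add_integral hG fun e x hx => ?_
    have h0 : (0 : ℝ) ∈ Icc 0 (Γ.len e) := ⟨le_rfl, (Γ.len_pos e).le⟩
    have hint : Tendsto (fun n => ∫ t in 0..x, g (φ n) e t) atTop (𝓝 (∫ t in 0..x, G e t)) := by
      rw [tendsto_iff_dist_tendsto_zero]
      have hb : Tendsto (fun n => √|x - 0| * √(Γ.integral
          (fun e x => (1 * g (φ n) e x + (-1) * G e x) ^ 2))) atTop (𝓝 0) := by
        have := ((Real.continuous_sqrt.tendsto 0).comp hG0).const_mul (√|x - 0|)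
        simpa using this
      refine squeeze_zero (fun _ => dist_nonneg) (fun n => ?_) hb
      have hgn := (hu (φ n)).isL2_deriv
      refine le_trans (le_of_eq ?_) (abs_integral_le_sqrt (hgn.lin hG 1 (-1)) h0 hx)
      rw [Real.dist_eq, ← intervalIntegral.integral_sub (hgn.intervalIntegrable_mono h0 hx)
        (hG.intervalIntegrable_mono h0 hx)]
      congr 2; ext t; ring
    -- Pass to the limit in the representation of u_n as a primitive of g_n.
    refine tendsto_nhds_unique (hU e x hx) ?_
    refine ((hU e 0 h0).add hint).congr fun n => ?_
    exact ((hu (φ n)).eq_add_integral e hx).symm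
  refine ⟨U, G, hUW, ContinuousAtVertices.of_tendsto (fun n => hc (φ n)) hU, ?_, ?_, ?_⟩
  · have := tendsto_integral_of_bounded (Γ := Γ) (f := fun n e x => u (φ n) e x ^ 2)
      (F := fun e x => U e x ^ 2) (B := (C * √R) ^ 2)
      (fun n e => ((hu (φ n) e).continuousOn).pow 2) (fun n e x hx => by
        rw [abs_pow]; exact pow_le_pow_left₀ (abs_nonneg _) (hM _ e x hx) 2)
      (fun e x hx => (hU e x hx).pow 2)
    simp only [h1] at this
    exact tendsto_nhds_unique this tendsto_const_nhds
  · have := tendsto_integral_of_bounded (Γ := Γ) (f := fun n e x => u (φ n) e x)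
      (F := U) (B := C * √R) (fun n e => (hu (φ n) e).continuousOn)
      (fun n e x hx => hM _ e x hx) hU
    simp only [hm] at this
    exact tendsto_nhds_unique this tendsto_const_nhds
  · simp only [hg] at hG1
    exact tendsto_nhds_unique hG1 hrφ

end Finite

end MetricGraph

/-! ### Minimizers are eigenfunctions; the spectral gap -/

theorem eq_zero_of_forall_quadratic_nonneg {a b : ℝ} (h : ∀ t : ℝ, 0 ≤ a * (t * t) + b * t) :
    b = 0 := by
  have := discrim_le_zero (a := a) (b := b) (c := 0) (by simpa using h)
  rw [discrim] at this
  nlinarith [sq_nonneg b]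

namespace MetricGraph

variable {V E : Type*} {Γ : MetricGraph V E}

/-- The linear interpolation of given vertex values is in the form domain. -/
theorem isW12_linear (c : V → ℝ) :
    Γ.IsW12 (fun e x => c (Γ.source e)
        + (c (Γ.target e) - c (Γ.source e)) / Γ.len e * x)
      (fun e _ => (c (Γ.target e) - c (Γ.source e)) / Γ.len e) :=
  isW12_of_hasDerivAt (fun _ => continuous_const) fun e x => by
    simpa using ((hasDerivAt_id x).const_mul
      ((c (Γ.target e) - c (Γ.source e)) / Γ.len e)).const_add (c (Γ.source e))

theorem continuousAtVertices_linear (c : V → ℝ) :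
    Γ.ContinuousAtVertices (fun e x => c (Γ.source e)
        + (c (Γ.target e) - c (Γ.source e)) / Γ.len e * x) :=
  ⟨c, fun e => by
    have := (Γ.len_pos e).ne'
    constructor
    · simp
    · field_simp; ring⟩

section Finite

variable [Fintype E]

-- Summation by parts on the graph: endpoint terms of the edges are regrouped by vertex, which turns
-- them into the Kirchhoff sums.
open Classical in
theorem sum_boundary_eq [Fintype V] (c : V → ℝ) (A B : E → ℝ) :
    ∑ e, (A e * c (Γ.target e) - B e * c (Γ.source e))
      = ∑ v, c v * ∑ e, ((if Γ.target e = v then A e else 0)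
          - (if Γ.source e = v then B e else 0)) := by
  simp only [Finset.mul_sum]
  rw [Finset.sum_comm]
  refine Finset.sum_congr rfl fun e _ => ?_
  simp only [mul_sub, Finset.sum_sub_distrib, mul_ite, mul_zero, Finset.sum_ite_eq,
    Finset.mem_univ, if_true]
  ring

theorem integral_by_parts {z f w h : E → ℝ → ℝ} (hz : Γ.IsW12 z f) (hw : Γ.IsW12 w h) :
    Γ.integral (fun e x => f e x * w e x) + Γ.integral (fun e x => z e x * h e x)
      = ∑ e, (z e (Γ.len e) * w e (Γ.len e) - z e 0 * w e 0) := by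
  rw [integral, integral, ← Finset.sum_add_distrib]
  refine Finset.sum_congr rfl fun e _ => ?_
  rw [← integral_mul_add_mul_of_eq_add_integral (Γ.len_pos e).le
    (hz.isL2_deriv.intervalIntegrable e) (hw.isL2_deriv.intervalIntegrable e)
    (fun x hx => hz.eq_add_integral e hx) (fun x hx => hw.eq_add_integral e hx),
    intervalIntegral.integral_add (hz.isL2_deriv.intervalIntegrable_mul hw.isL2 e)
      (hz.isL2.intervalIntegrable_mul hw.isL2_deriv e)]

/-- Green's formula: the boundary terms vanish under the Kirchhoff condition. -/
theorem green [Finite V] {z f w h : E → ℝ → ℝ} (hz : Γ.IsW12 z f) (hk : Γ.Kirchhoff z)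
    (hw : Γ.IsW12 w h) (hc : Γ.ContinuousAtVertices w) :
    Γ.integral (fun e x => f e x * w e x) + Γ.integral (fun e x => z e x * h e x) = 0 := by
  have := Fintype.ofFinite V
  obtain ⟨c, hc⟩ := hc
  rw [integral_by_parts hz hw]
  simp only [fun e => (hc e).1, fun e => (hc e).2]
  rw [sum_boundary_eq c]
  exact Finset.sum_eq_zero fun v _ => by rw [hk v, mul_zero]

theorem integral_congr_ae' {f f' : E → ℝ → ℝ}
    (h : ∀ e, ∀ᵐ x ∂volume.restrict (Ioo 0 (Γ.len e)), f e x = f' e x) :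
    Γ.integral f = Γ.integral f' := by
  refine Finset.sum_congr rfl fun e _ => ?_
  rw [intervalIntegral_eq_setIntegral_Ioo (Γ.len_pos e).le,
    intervalIntegral_eq_setIntegral_Ioo (Γ.len_pos e).le]
  exact integral_congr_ae (h e)

theorem integral_const_mul (a : ℝ) (f : E → ℝ → ℝ) :
    Γ.integral (fun e x => a * f e x) = a * Γ.integral f := by
  simp [integral, Finset.mul_sum]

/-- Green's formula with w = 1 gives μ∫u = 0, hence mean zero because μ ≠ 0; with w = u it gives
∫|u'|² = μ∫u². -/
theorem nonzeroEigenvalues_subset_rayleighQuotients [Finite V] (Γ : MetricGraph V E) :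
    Γ.nonzeroEigenvalues ⊆ Γ.rayleighQuotients := by
  rintro μ ⟨hμ, u, f, ⟨g, hu, hg, hc, hk⟩, h0, hf⟩
  have g1 := green hg hk hu hc
  have g2 := green hg hk (isW12_const 1) (continuousAtVertices_const 1)
  have e1 : Γ.integral (fun e x => f e x * u e x)
      = -μ * Γ.integral (fun e x => u e x ^ 2) := by
    rw [← integral_const_mul]
    refine integral_congr_ae' fun e => ?_
    filter_upwards [hf e] with x hx
    linear_combination -u e x * hx
  have e2 : Γ.integral (fun e x => f e x * 1) = -μ * Γ.integral u := by
    rw [← integral_const_mul]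
    refine integral_congr_ae' fun e => ?_
    filter_upwards [hf e] with x hx
    linear_combination -hx
  have e3 : Γ.integral (fun e x => g e x * 0) = 0 := by simp [integral]
  have e4 : Γ.integral (fun e x => g e x * g e x) = Γ.integral (fun e x => g e x ^ 2) := by
    simp only [sq]
  refine ⟨u, g, hu, hc, h0, ?_, ?_⟩
  · rw [e2, e3] at g2
    simpa [hμ] using g2
  · rw [e1, e4] at g1
    rw [eq_div_iff h0]
    linarith

/-- The weak form of the eigenvalue equation for a minimizer of the Rayleigh quotient. -/
theorem weak_eigenvalue_equation [Nonempty E] {u g : E → ℝ → ℝ} (hu : Γ.IsW12 u g)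
    (hc : Γ.ContinuousAtVertices u) (hm : Γ.integral u = 0)
    (hmin : Γ.integral (fun e x => g e x ^ 2)
      = sInf Γ.rayleighQuotients * Γ.integral (fun e x => u e x ^ 2))
    {w h : E → ℝ → ℝ} (hw : Γ.IsW12 w h) (hcw : Γ.ContinuousAtVertices w) :
    Γ.integral (fun e x => g e x * h e x)
      = sInf Γ.rayleighQuotients * Γ.integral (fun e x => u e x * w e x) := by
  wlog hmw : Γ.integral w = 0 generalizing w h
  -- Subtracting the mean of `w` changes neither its derivative nor its pairing with the mean-zero
  -- `u`.
  · set m := Γ.integral w / ∑ e, Γ.len e with hmdef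
    have hlen := Γ.sum_len_pos
    have := this (hw.lin (isW12_const m) 1 (-1)) (hcw.lin (continuousAtVertices_const m) 1 (-1))
      (by
        rw [integral_lin hw.isL2.intervalIntegrable (by simp), integral_const, hmdef]
        field_simp
        ring)
    simp only [mul_zero, add_zero, one_mul] at this
    rw [this]
    have e : Γ.integral (fun e x => u e x * (w e x + -1 * m))
        = 1 * Γ.integral (fun e x => u e x * w e x) + (-m) * Γ.integral u := by
      rw [← integral_lin (hu.isL2.intervalIntegrable_mul hw.isL2) hu.isL2.intervalIntegrable]
      congr 1; ext e x; ring
    rw [e, hm]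
    ring
  -- The functional ∫(g + th)² - λ∫(u + tw)² is nonnegative for all t and vanishes at t = 0 by
  -- `hmin`, so its linear coefficient is zero.
  have := eq_zero_of_forall_quadratic_nonneg
    (a := Γ.integral (fun e x => h e x ^ 2)
      - sInf Γ.rayleighQuotients * Γ.integral (fun e x => w e x ^ 2))
    (b := 2 * (Γ.integral (fun e x => g e x * h e x)
      - sInf Γ.rayleighQuotients * Γ.integral (fun e x => u e x * w e x))) (fun t => by
    have := sInf_rayleighQuotients_mul_le (hu.lin hw 1 t) (hc.lin hcw 1 t) (by
      rw [integral_lin hu.isL2.intervalIntegrable hw.isL2.intervalIntegrable, hm, hmw]; ring)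
    rw [integral_sq_lin hu.isL2 hw.isL2, integral_sq_lin hu.isL2_deriv hw.isL2_deriv, hmin] at this
    linarith)
  linarith

theorem integral_ite [DecidableEq E] (e₀ : E) (f : E → ℝ → ℝ) :
    Γ.integral (fun e x => if e = e₀ then f e x else 0) = ∫ x in 0..Γ.len e₀, f e₀ x := by
  rw [integral, Finset.sum_eq_single e₀]
  · simp
  · intro e _ he; simp [he]
  · simp

/-- A minimizer of the Rayleigh quotient is an eigenfunction. -/
theorem exists_eigenfunction [Finite V] [Nonempty E] (hΓ : Γ.toSimpleGraph.Connected) :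
    ∃ u g : E → ℝ → ℝ, Γ.IsW12 u g ∧
      Γ.IsW12 g (fun e x => -sInf Γ.rayleighQuotients * u e x) ∧
      Γ.ContinuousAtVertices u ∧ Γ.Kirchhoff g ∧
      Γ.integral (fun e x => u e x ^ 2) = 1 ∧ Γ.integral u = 0 ∧
      Γ.integral (fun e x => g e x ^ 2) = sInf Γ.rayleighQuotients := by
  classical
  have := Fintype.ofFinite V
  obtain ⟨u, g, hu, hc, h1, hm, hq⟩ := exists_minimizer hΓ
  set lam := sInf Γ.rayleighQuotients with hlam
  have hf : ∀ e, IntervalIntegrable (fun x => -lam * u e x) volume 0 (Γ.len e) :=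
    fun e => (hu.isL2.intervalIntegrable e).const_mul _
  have hk : ∀ e, ∃ k, ∀ᵐ x ∂volume.restrict (Ioo 0 (Γ.len e)),
      g e x = k + ∫ t in 0..x, -lam * u e t := by
    intro e₀
    refine exists_ae_eq_add_integral_of_weak_deriv (Γ.len_pos e₀)
      (hu.isL2_deriv.intervalIntegrable e₀) (hf e₀) fun φ hφ hφc hφs => ?_
    -- A test function supported inside the single edge `e₀` localizes the weak equation there.
    have hW : Γ.IsW12 (fun e x => if e = e₀ then φ x else 0)
        (fun e x => if e = e₀ then deriv φ x else 0) := by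
      refine isW12_of_hasDerivAt (fun e => ?_) fun e x => ?_
      · by_cases he : e = e₀
        · simp only [he, if_true]; exact hφ.continuous_deriv (by simp)
        · simp only [he, if_false]; exact continuous_const
      · by_cases he : e = e₀
        · simp only [he, if_true]; exact (hφ.differentiable (by simp) x).hasDerivAt
        · simp only [he, if_false]; exact hasDerivAt_const _ _
    have hWc : Γ.ContinuousAtVertices (fun e x => if e = e₀ then φ x else 0) :=
      ⟨0, fun e => by
        by_cases he : e = e₀
        · subst he
          simp [eq_zero_of_tsupport_subset_Ioo hφs (x := 0) (by simp),
            eq_zero_of_tsupport_subset_Ioo hφs (x := Γ.len e) (by simp)]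
        · simp [he]⟩
    have := weak_eigenvalue_equation hu hc hm (by rw [h1, mul_one]; exact hq) hW hWc
    simp only [mul_ite, mul_zero] at this
    rw [integral_ite e₀ (fun e x => g e x * deriv φ x),
      integral_ite e₀ (fun e x => u e x * φ x)] at this
    rw [this, ← hlam, ← intervalIntegral.integral_const_mul, ← intervalIntegral.integral_neg]
    congr 1; ext x; ring
  choose k hk using hk
  -- The L² derivative `g` has no meaningful endpoint values; the Kirchhoff condition is proved for
  -- this continuous representative.
  set G : E → ℝ → ℝ := fun e x => k e + ∫ t in 0..x, -lam * u e t with hG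
  have huG : Γ.IsW12 u G := hu.congr hk
  have hGW : Γ.IsW12 G (fun e x => -lam * u e x) :=
    isW12_of_eq_add_integral (fun e => (hu.isL2 e).const_mul _) (by simp [hG])
  have hqG : Γ.integral (fun e x => G e x ^ 2) = lam := by
    rw [← hq]
    refine integral_congr_ae' fun e => ?_
    filter_upwards [hk e] with x hx
    rw [hx]
  refine ⟨u, G, huG, hGW, hc, fun v => ?_, h1, hm, hqG⟩
  -- Test with the function that is 1 at `v`, 0 at the other vertices and linear on edges: since G'
  -- = -λu the integrals cancel, and only the Kirchhoff sum at `v` remains.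
  have hw := isW12_linear (Γ := Γ) (Pi.single v 1)
  have hwc := continuousAtVertices_linear (Γ := Γ) (Pi.single v 1)
  have a1 := weak_eigenvalue_equation huG hc hm (by rw [h1, mul_one]; exact hqG) hw hwc
  have a2 := integral_by_parts hGW hw
  obtain ⟨c, hcw⟩ := hwc
  rw [a1, ← hlam] at a2
  simp only [mul_assoc (-lam)] at a2
  rw [integral_const_mul, neg_mul, neg_add_cancel] at a2
  have a3 := sum_boundary_eq (Γ := Γ) (Pi.single v (1 : ℝ)) (fun e => G e (Γ.len e))
    (fun e => G e 0)
  rw [Finset.sum_eq_single v (fun b _ hb => by simp [hb]) (by simp)] at a3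
  simp only [Pi.single_eq_same, one_mul] at a3
  rw [Finset.sum_congr rfl fun e _ => ?_] at a2
  · exact (a3.symm.trans a2.symm)
  · have := (Γ.len_pos e).ne'
    have e1 : ∀ a b : ℝ, a + (b - a) / Γ.len e * Γ.len e = b := by
      intro a b; field_simp; ring
    simp only [e1, mul_zero, add_zero]

/-- If the infimum were 0, the sup bound would make the minimizer vanish, contradicting its unit
norm. -/
theorem sInf_rayleighQuotients_pos [Finite V] [Nonempty E] (hΓ : Γ.toSimpleGraph.Connected) :
    0 < sInf Γ.rayleighQuotients := by
  obtain ⟨u, g, hu, hc, h1, hm, hq⟩ := exists_minimizer hΓ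
  obtain ⟨C, -, hC⟩ := exists_sup_bound hΓ
  refine lt_of_le_of_ne (Real.sInf_nonneg fun _ hr => rayleighQuotients_nonneg hr) fun h0 => ?_
  have hz : ∀ e, ∀ x ∈ Icc 0 (Γ.len e), u e x = 0 := fun e x hx => by
    simpa [hq, ← h0] using hC u g hu hc hm e x hx
  have := integral_mono hu.isL2.intervalIntegrable_sq (w := fun _ _ => 0) (by simp)
    (fun e x hx => by simp [hz e x hx])
  rw [h1, integral_const] at this
  linarith

theorem isLeast_nonzeroEigenvalues_sInf_rayleighQuotients [Finite V] [Nonempty E]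
    (hΓ : Γ.toSimpleGraph.Connected) :
    IsLeast Γ.nonzeroEigenvalues (sInf Γ.rayleighQuotients) := by
  obtain ⟨u, g, hu, hg, hc, hk, h1, -, -⟩ := exists_eigenfunction hΓ
  refine ⟨⟨(sInf_rayleighQuotients_pos hΓ).ne', u, _, ⟨g, hu, hg, hc, hk⟩, by rw [h1]; simp,
    fun e => ae_of_all _ fun x => by ring⟩, fun μ hμ => ?_⟩
  exact csInf_le bddBelow_rayleighQuotients (nonzeroEigenvalues_subset_rayleighQuotients Γ hμ)

theorem spectralGap_eq_sInf_rayleighQuotients [Finite V] [Nonempty E]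
    (hΓ : Γ.toSimpleGraph.Connected) : Γ.spectralGap = sInf Γ.rayleighQuotients :=
  (isLeast_nonzeroEigenvalues_sInf_rayleighQuotients hΓ).csInf_eq

end Finite

end MetricGraph

/-! ### Medians and a smooth approximation of the step function -/

/-- Finite measures on the real line have medians. -/
theorem exists_median (μ : Measure ℝ) [IsFiniteMeasure μ] :
    ∃ m : ℝ, 2 * μ (Ioi m) ≤ μ univ ∧ 2 * μ (Iio m) ≤ μ univ := by
  rcases eq_or_ne (μ univ) 0 with h0 | h0
  · rw [Measure.measure_univ_eq_zero] at h0
    exact ⟨0, by simp [h0]⟩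
  have hsplit : ∀ s : ℝ, μ univ = μ (Iic s) + μ (Ioi s) := fun s => by
    rw [← compl_Iic, measure_add_measure_compl measurableSet_Iic]
  have hfin : μ univ ≠ ⊤ := measure_ne_top μ univ
  have hlt : μ univ / 2 < μ univ := ENNReal.half_lt_self h0 hfin
  have hlower : ∀ s : ℝ, ¬ 2 * μ (Ioi s) ≤ μ univ → 2 * μ (Iic s) ≤ μ univ := by
    intro s hs
    rw [not_le, hsplit s, two_mul] at hs
    rw [hsplit s, two_mul]
    exact add_le_add_right (lt_of_add_lt_add_right hs).le _
  have hmono : ∀ {s t : ℝ}, s ≤ t → 2 * μ (Ioi s) ≤ μ univ → 2 * μ (Ioi t) ≤ μ univ := by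
    intro s t hst h
    refine le_trans ?_ h
    gcongr
  -- The median is the infimum of `S`. Points above it lie in `S` by monotonicity and points below
  -- it do not; both open half-lines are increasing unions, so continuity of the measure from below
  -- gives the two bounds at the infimum itself.
  set S := {s : ℝ | 2 * μ (Ioi s) ≤ μ univ}
  have hne : S.Nonempty := by
    by_contra hS
    rw [not_nonempty_iff_eq_empty] at hS
    have h1 : ∀ s : ℝ, μ (Iic s) ≤ μ univ / 2 := fun s => by
      rw [ENNReal.le_div_iff_mul_le (by simp) (by simp), mul_comm]
      exact hlower s fun h => by
        have : s ∈ S := h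
        simp [hS] at this
    exact absurd (le_of_tendsto' (tendsto_measure_Iic_atTop μ) h1) (not_le.2 hlt)
  have hbdd : BddBelow S := by
    have h1 := tendsto_measure_Ici_atBot μ
    obtain ⟨s, hs⟩ := (h1.eventually (lt_mem_nhds hlt)).exists
    refine ⟨s - 1, fun r hr => ?_⟩
    by_contra! hrs
    have h2 : μ (Ici s) ≤ μ (Ioi r) := measure_mono fun x hx => by
      simp only [mem_Ici, mem_Ioi] at *; linarith
    have h3 : μ (Ioi r) ≤ μ univ / 2 := by
      rw [ENNReal.le_div_iff_mul_le (by simp) (by simp), mul_comm]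
      exact hr
    exact absurd (h2.trans h3) (not_le.2 hs)
  have hpos : ∀ n : ℕ, (0 : ℝ) < 1 / (n + 1) := fun n => by positivity
  have hanti : Antitone fun n : ℕ => (1 : ℝ) / (n + 1) := fun a b hab => by
    apply one_div_le_one_div_of_le (by positivity)
    have : (a : ℝ) ≤ b := by exact_mod_cast hab
    linarith
  refine ⟨sInf S, ?_, ?_⟩
  · have hU : Ioi (sInf S) = ⋃ n : ℕ, Ioi (sInf S + 1 / (n + 1)) := by
      ext x
      simp only [mem_Ioi, mem_iUnion]
      constructor
      · intro hx
        obtain ⟨n, hn⟩ := exists_nat_one_div_lt (sub_pos.2 hx)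
        exact ⟨n, by linarith⟩
      · rintro ⟨n, hn⟩
        linarith [hpos n]
    rw [hU, Monotone.measure_iUnion, ENNReal.mul_iSup]
    · refine iSup_le fun n => ?_
      obtain ⟨s, hs, hsn⟩ := exists_lt_of_csInf_lt hne (lt_add_of_pos_right (sInf S) (hpos n))
      exact hmono hsn.le hs
    · intro a b hab
      exact Ioi_subset_Ioi (by linarith [hanti hab])
  · have hU : Iio (sInf S) = ⋃ n : ℕ, Iic (sInf S - 1 / (n + 1)) := by
      ext x
      simp only [mem_Iio, mem_Iic, mem_iUnion]
      constructor
      · intro hx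
        obtain ⟨n, hn⟩ := exists_nat_one_div_lt (sub_pos.2 hx)
        exact ⟨n, by linarith⟩
      · rintro ⟨n, hn⟩
        linarith [hpos n]
    rw [hU, Monotone.measure_iUnion, ENNReal.mul_iSup]
    · refine iSup_le fun n => hlower _ fun h => ?_
      linarith [csInf_le hbdd (show sInf S - 1 / (n + 1) ∈ S from h), hpos n]
    · intro a b hab
      exact Iic_subset_Iic.2 (by linarith [hanti hab])

/-- A continuous probability density supported in `[0, 1]`. -/
noncomputable def kernelDensity (s : ℝ) : ℝ := max 0 (6 * s * (1 - s))

theorem continuous_kernelDensity : Continuous kernelDensity := by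
  unfold kernelDensity; fun_prop

theorem kernelDensity_nonneg (s : ℝ) : 0 ≤ kernelDensity s := le_max_left _ _

theorem kernelDensity_eq_zero {s : ℝ} (hs : s ≤ 0 ∨ 1 ≤ s) : kernelDensity s = 0 := by
  apply max_eq_left
  rcases hs with hs | hs <;> nlinarith

theorem intervalIntegral_kernelDensity : ∫ s in (0 : ℝ)..1, kernelDensity s = 1 := by
  rw [intervalIntegral.integral_congr (g := fun s => 6 * s * (1 - s))]
  · rw [intervalIntegral.integral_eq_sub_of_hasDerivAt (f := fun s => 3 * s ^ 2 - 2 * s ^ 3)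
      (fun x _ => ?_) (Continuous.intervalIntegrable (by fun_prop) _ _)]
    · norm_num
    · have h := ((hasDerivAt_pow 2 x).const_mul 3).sub ((hasDerivAt_pow 3 x).const_mul 2)
      convert! h using 1
      norm_num; ring
  · intro s hs
    rw [uIcc_of_le zero_le_one] at hs
    exact max_eq_right (by nlinarith [hs.1, hs.2, mul_nonneg hs.1 (sub_nonneg.2 hs.2)])

theorem integrable_kernelDensity : Integrable kernelDensity :=
  continuous_kernelDensity.integrable_of_hasCompactSupport
    (HasCompactSupport.intro (isCompact_Icc (a := 0) (b := 1)) fun x hx =>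
      kernelDensity_eq_zero (by
        by_contra! h
        exact hx ⟨h.1.le, h.2.le⟩))

theorem integral_kernelDensity : ∫ s, kernelDensity s = 1 := by
  rw [← intervalIntegral_kernelDensity, intervalIntegral.integral_of_le zero_le_one]
  symm
  apply setIntegral_eq_integral_of_forall_compl_eq_zero
  intro x hx
  apply kernelDensity_eq_zero
  by_contra! h
  exact hx ⟨h.1, h.2.le⟩

/-- The integral runs over the level `t`, not over the space variable: this is what Tonelli needs in
the coarea inequality. -/
theorem lintegral_kernelDensity {a : ℝ} (ha : 0 < a) (y : ℝ) :
    ∫⁻ t, ENNReal.ofReal (a * kernelDensity (a * (y - t))) = 1 := by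
  rw [← ofReal_integral_eq_lintegral_ofReal]
  · rw [integral_sub_left_eq_self (fun s => a * kernelDensity (a * s)) volume y,
      integral_const_mul, Measure.integral_comp_mul_left, integral_kernelDensity,
      abs_of_pos (inv_pos.2 ha)]
    simp [ha.ne']
  · exact ((integrable_kernelDensity.comp_mul_left' ha.ne').const_mul a).comp_sub_left y
  · exact ae_of_all _ fun t => mul_nonneg ha.le (kernelDensity_nonneg _)

/-- A continuously differentiable function increasing from `0` to `1` on `[0, 1]`. -/
noncomputable def kernelStep (s : ℝ) : ℝ := ∫ t in 0..s, kernelDensity t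

theorem hasDerivAt_kernelStep (s : ℝ) : HasDerivAt kernelStep (kernelDensity s) s :=
  (continuous_kernelDensity.integral_hasStrictDerivAt 0 s).hasDerivAt

theorem continuous_kernelStep : Continuous kernelStep :=
  continuous_iff_continuousAt.2 fun s => (hasDerivAt_kernelStep s).continuousAt

theorem monotone_kernelStep : Monotone kernelStep :=
  monotone_of_hasDerivAt_nonneg hasDerivAt_kernelStep kernelDensity_nonneg

theorem kernelStep_of_nonpos {s : ℝ} (hs : s ≤ 0) : kernelStep s = 0 := by
  rw [kernelStep, intervalIntegral.integral_congr (g := fun _ => 0),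
    intervalIntegral.integral_zero]
  intro t ht
  rw [uIcc_of_ge hs] at ht
  exact kernelDensity_eq_zero (Or.inl ht.2)

theorem kernelStep_of_one_le {s : ℝ} (hs : 1 ≤ s) : kernelStep s = 1 := by
  rw [kernelStep, ← intervalIntegral.integral_add_adjacent_intervals (b := 1)
    (continuous_kernelDensity.intervalIntegrable _ _)
    (continuous_kernelDensity.intervalIntegrable _ _), intervalIntegral_kernelDensity,
    intervalIntegral.integral_congr (a := 1) (g := fun _ => 0), intervalIntegral.integral_zero,
    add_zero]
  intro t ht
  rw [uIcc_of_le hs] at ht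
  exact kernelDensity_eq_zero (Or.inr ht.1)

theorem abs_kernelStep_le (s : ℝ) : |kernelStep s| ≤ 1 := by
  rw [abs_le]
  constructor
  · have := monotone_kernelStep (min_le_left s 0)
    rw [kernelStep_of_nonpos (min_le_right s 0)] at this
    linarith
  · have := monotone_kernelStep (le_max_left s 1)
    rwa [kernelStep_of_one_le (le_max_right s 1)] at this

/-- The density lives on [0, 1] rather than around 0, so the limit at y = 0 is 0: exactly the
indicator of a strict superlevel set, at every level. -/
theorem tendsto_kernelStep (y : ℝ) :
    Tendsto (fun n : ℕ => kernelStep ((n + 1) * y)) atTop (𝓝 (if 0 < y then 1 else 0)) := by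
  split_ifs with hy
  · have h1 : Tendsto (fun n : ℕ => ((n : ℝ) + 1) * y) atTop atTop :=
      (tendsto_natCast_atTop_atTop.atTop_add tendsto_const_nhds).atTop_mul_const hy
    refine tendsto_const_nhds.congr' ?_
    filter_upwards [h1.eventually_ge_atTop 1] with n hn
    exact (kernelStep_of_one_le hn).symm
  · refine tendsto_const_nhds.congr fun n => ?_
    rw [kernelStep_of_nonpos]
    exact mul_nonpos_of_nonneg_of_nonpos (by positivity) (not_lt.1 hy)

/-- The signed square is C¹ even at 0, so `v * |v|` can enter the coarea inequality directly. The
derivative at 0 is obtained from the continuous extension of the derivative elsewhere. -/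
theorem hasDerivAt_mul_abs (x : ℝ) : HasDerivAt (fun s : ℝ => s * |s|) (2 * |x|) x := by
  refine hasDerivAt_of_hasDerivAt_of_ne' (x := 0) (g := fun s => 2 * |s|) (fun y hy => ?_)
    (by fun_prop) (by fun_prop) x
  rcases lt_or_gt_of_ne hy with h | h
  · have h1 : HasDerivAt (fun s : ℝ => -s ^ 2) (2 * |y|) y := by
      convert! (hasDerivAt_pow 2 y).neg using 1
      rw [abs_of_neg h]; norm_num
    refine h1.congr_of_eventuallyEq ?_
    filter_upwards [Iio_mem_nhds h] with s hs
    rw [abs_of_neg hs]; ring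
  · have h1 : HasDerivAt (fun s : ℝ => s ^ 2) (2 * |y|) y := by
      convert! hasDerivAt_pow 2 y using 1
      rw [abs_of_pos h]; norm_num
    refine h1.congr_of_eventuallyEq ?_
    filter_upwards [Ioi_mem_nhds h] with s hs
    rw [abs_of_pos hs]; ring

/-! ### Coarea inequality and Cheeger's inequality -/

namespace MetricGraph

variable {V E : Type*} {Γ : MetricGraph V E}

/-- The set where the function with vertex values `c` and edge functions `F` is larger than `t`. -/
def superlevel (Γ : MetricGraph V E) (c : V → ℝ) (F : E → ℝ → ℝ) (t : ℝ) : Set Γ.Point :=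
  {p | t < match p with
    | .vertex v => c v
    | .inner e x => F e x}

/-- The set lives on the glued graph, where edge endpoints are vertices; the compatibility of `F`
with `c` is what makes its trace on a closed edge the ordinary superlevel set. -/
theorem coords_superlevel {c : V → ℝ} {F : E → ℝ → ℝ}
    (hc : ∀ e, F e 0 = c (Γ.source e) ∧ F e (Γ.len e) = c (Γ.target e)) (t : ℝ) (e : E) :
    Γ.coords (Γ.superlevel c F t) e = {x | x ∈ Icc 0 (Γ.len e) ∧ t < F e x} := by
  ext x
  simp only [coords, mem_ofPred_eq]
  refine and_congr_right fun hx => ?_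
  rw [point]
  split_ifs with h1 h2
  · rfl
  · have : x = 0 := le_antisymm h2 hx.1
    subst this
    rw [(hc e).1]; rfl
  · have : x = Γ.len e := le_antisymm hx.2 (not_lt.1 fun h => h1 ⟨not_le.1 h2, h⟩)
    subst this
    rw [(hc e).2]; rfl

section Finite

variable [Fintype E]

theorem enorm_integral_le (f : E → ℝ → ℝ) :
    ENNReal.ofReal |Γ.integral f| ≤ ∑ e, ∫⁻ x in Icc 0 (Γ.len e), ‖f e x‖ₑ := by
  rw [← Real.enorm_eq_ofReal_abs, integral]
  refine (enorm_sum_le _ _).trans (Finset.sum_le_sum fun e _ => ?_)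
  rw [intervalIntegral.integral_of_le (Γ.len_pos e).le, ← integral_Icc_eq_integral_Ioc]
  exact enorm_integral_le_lintegral_enorm _

/-- The perimeter of a superlevel set is bounded by averages of the derivative over thin layers. -/
theorem perimeter_superlevel_le [Finite V] {c : V → ℝ} {F F' : E → ℝ → ℝ}
    (hF : ∀ e x, HasDerivAt (F e) (F' e x) x) (hF' : ∀ e, Continuous (F' e))
    (hc : ∀ e, F e 0 = c (Γ.source e) ∧ F e (Γ.len e) = c (Γ.target e)) (t : ℝ) :
    Γ.perimeter (Γ.superlevel c F t) ≤ liminf (fun n : ℕ => ∑ e, ∫⁻ x in Icc 0 (Γ.len e),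
      ENNReal.ofReal ((n + 1) * kernelDensity ((n + 1) * (F e x - t))) * ‖F' e x‖ₑ) atTop := by
  have hFc : ∀ e, Continuous (F e) := fun e =>
    continuous_iff_continuousAt.2 fun x => (hF e x).continuousAt
  refine iSup_le fun z => iSup_le fun g => iSup_le fun hz => iSup_le fun hk => iSup_le fun hz1 => ?_
  have hlim : Tendsto (fun n : ℕ => Γ.integral fun e x =>
      kernelStep ((n + 1) * (F e x - t)) * g e x) atTop
      (𝓝 (Γ.integral fun e x => Γ.indicator (Γ.superlevel c F t) e x * g e x)) := by
    refine tendsto_finsetSum _ fun e _ => ?_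
    have hge := (hz.isL2_deriv.intervalIntegrable e)
    refine intervalIntegral.tendsto_integral_filter_of_dominated_convergence (fun x => ‖g e x‖)
      (Eventually.of_forall fun n => ?_) (Eventually.of_forall fun n => ?_) hge.norm ?_
    · have h1 : Continuous fun x => kernelStep (((n : ℝ) + 1) * (F e x - t)) :=
        continuous_kernelStep.comp (continuous_const.mul ((hFc e).sub continuous_const))
      exact h1.aestronglyMeasurable.mul hge.aestronglyMeasurable_restrict_uIoc
    · refine ae_of_all _ fun x _ => ?_
      rw [norm_mul]
      exact mul_le_of_le_one_left (norm_nonneg _) (abs_kernelStep_le _)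
    · refine ae_of_all _ fun x hx => ?_
      rw [uIoc_of_le (Γ.len_pos e).le] at hx
      refine Tendsto.mul_const _ ?_
      have h1 := tendsto_kernelStep (F e x - t)
      convert! h1 using 2
      rw [indicator, coords_superlevel hc, indicator_apply]
      simp only [mem_ofPred_eq, Ioc_subset_Icc_self hx, true_and, sub_pos, Pi.one_apply]
  have hle : ∀ n : ℕ, ENNReal.ofReal |Γ.integral fun e x =>
      kernelStep ((n + 1) * (F e x - t)) * g e x| ≤ ∑ e, ∫⁻ x in Icc 0 (Γ.len e),
        ENNReal.ofReal ((n + 1) * kernelDensity ((n + 1) * (F e x - t))) * ‖F' e x‖ₑ := by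
    intro n
    have hW : Γ.IsW12 (fun e x => kernelStep (((n : ℝ) + 1) * (F e x - t)))
        (fun e x => kernelDensity (((n : ℝ) + 1) * (F e x - t)) * (((n : ℝ) + 1) * F' e x)) := by
      refine isW12_of_hasDerivAt (fun e => ?_) fun e x => ?_
      · exact (continuous_kernelDensity.comp
          (continuous_const.mul ((hFc e).sub continuous_const))).mul (continuous_const.mul (hF' e))
      · exact (hasDerivAt_kernelStep _).comp x (((hF e x).sub_const t).const_mul _)
    have hWc : Γ.ContinuousAtVertices (fun e x => kernelStep (((n : ℝ) + 1) * (F e x - t))) :=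
      ⟨fun v => kernelStep (((n : ℝ) + 1) * (c v - t)), fun e => by
        simp only [(hc e).1, (hc e).2, and_self]⟩
    -- The smoothed indicator is continuous at the vertices, so the Kirchhoff condition on `z`
    -- removes all boundary terms.
    have hgreen := green hz hk hW hWc
    have e1 : Γ.integral (fun e x => kernelStep (((n : ℝ) + 1) * (F e x - t)) * g e x)
        = -Γ.integral (fun e x => z e x
          * (kernelDensity (((n : ℝ) + 1) * (F e x - t)) * (((n : ℝ) + 1) * F' e x))) := by
      rw [← eq_neg_of_add_eq_zero_left hgreen]
      congr 1; ext e x; ring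
    rw [e1, abs_neg]
    refine (enorm_integral_le _).trans (Finset.sum_le_sum fun e _ => ?_)
    refine setLIntegral_mono' measurableSet_Icc fun x hx => ?_
    have hρ := kernelDensity_nonneg (((n : ℝ) + 1) * (F e x - t))
    rw [enorm_mul]
    have hz1' : ‖z e x‖ₑ ≤ 1 := by
      rw [Real.enorm_eq_ofReal_abs, ENNReal.ofReal_le_one]; exact hz1 e x hx
    refine (mul_le_of_le_one_left zero_le hz1').trans (le_of_eq ?_)
    rw [← mul_assoc, enorm_mul, mul_comm (kernelDensity _), Real.enorm_of_nonneg (by positivity)]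
  have h1 : Tendsto (fun n : ℕ => ENNReal.ofReal |Γ.integral fun e x =>
      kernelStep ((n + 1) * (F e x - t)) * g e x|) atTop
      (𝓝 (ENNReal.ofReal |Γ.integral fun e x =>
        Γ.indicator (Γ.superlevel c F t) e x * g e x|)) :=
    ENNReal.tendsto_ofReal hlim.abs
  rw [← h1.liminf_eq]
  exact liminf_le_liminf (Eventually.of_forall hle)

/-- One half of the coarea formula. -/
theorem lintegral_perimeter_superlevel_le [Finite V] {c : V → ℝ} {F F' : E → ℝ → ℝ}
    (hF : ∀ e x, HasDerivAt (F e) (F' e x) x) (hF' : ∀ e, Continuous (F' e))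
    (hc : ∀ e, F e 0 = c (Γ.source e) ∧ F e (Γ.len e) = c (Γ.target e)) :
    ∫⁻ t in Ioi 0, Γ.perimeter (Γ.superlevel c F t)
      ≤ ∑ e, ∫⁻ x in Icc 0 (Γ.len e), if 0 < F e x then ‖F' e x‖ₑ else 0 := by
  have hFc : ∀ e, Continuous (F e) := fun e =>
    continuous_iff_continuousAt.2 fun x => (hF e x).continuousAt
  have hcont : ∀ (n : ℕ) (e : E), Continuous fun p : ℝ × ℝ =>
      ENNReal.ofReal (((n : ℝ) + 1) * kernelDensity ((n + 1) * (F e p.2 - p.1)))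
        * ‖F' e p.2‖ₑ := by
    intro n e
    have h1 : Continuous fun p : ℝ × ℝ =>
        ((n : ℝ) + 1) * kernelDensity (((n : ℝ) + 1) * (F e p.2 - p.1)) :=
      continuous_const.mul (continuous_kernelDensity.comp
        (continuous_const.mul (((hFc e).comp continuous_snd).sub continuous_fst)))
    have h2 : Continuous fun p : ℝ × ℝ => ‖F' e p.2‖ₑ := ((hF' e).comp continuous_snd).enorm
    exact (ENNReal.continuous_ofReal.comp h1).ennreal_mul h2
      (fun p => Or.inr enorm_ne_top) (fun p => Or.inr ENNReal.ofReal_ne_top)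
  refine (lintegral_mono fun t => perimeter_superlevel_le hF hF' hc t).trans ?_
  refine (lintegral_liminf_le fun n => Finset.measurable_fun_sum _ fun e _ =>
    (hcont n e).measurable.lintegral_prod_right').trans ?_
  -- After Fatou, a bound for each fixed n suffices.
  refine liminf_le_of_le (by isBoundedDefault) fun b hb => ?_
  obtain ⟨n, hn⟩ := hb.exists
  refine hn.trans ?_
  rw [lintegral_finsetSum _ fun e _ => (hcont n e).measurable.lintegral_prod_right']
  refine Finset.sum_le_sum fun e _ => ?_
  rw [lintegral_lintegral_swap (hcont n e).measurable.aemeasurable]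
  refine lintegral_mono fun x => ?_
  have hn0 : (0 : ℝ) < n + 1 := by positivity
  dsimp only
  split_ifs with hx
  · rw [lintegral_mul_const (f := fun t => ENNReal.ofReal
      (((n : ℝ) + 1) * kernelDensity ((n + 1) * (F e x - t)))) _ (by
        have := continuous_kernelDensity.measurable
        fun_prop)]
    refine mul_le_of_le_one_left zero_le ?_
    exact (setLIntegral_le_lintegral _ _).trans (lintegral_kernelDensity hn0 _).le
  -- Where F ≤ 0, levels t > 0 make the argument of the kernel negative, so such points contribute
  -- nothing.
  · rw [setLIntegral_congr_fun (g := fun _ => 0) measurableSet_Ioi, lintegral_zero]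
    intro t ht
    have : kernelDensity (((n : ℝ) + 1) * (F e x - t)) = 0 := by
      refine kernelDensity_eq_zero (Or.inl ?_)
      rw [mem_Ioi] at ht
      exact mul_nonpos_of_nonneg_of_nonpos hn0.le (by linarith)
    simp [this]

theorem length_univ (Γ : MetricGraph V E) : Γ.length univ = ∑ e, ENNReal.ofReal (Γ.len e) := by
  refine Finset.sum_congr rfl fun e _ => ?_
  have : Γ.coords univ e = Icc 0 (Γ.len e) := by ext x; simp [coords]
  rw [this, Real.volume_Icc, sub_zero]

theorem length_univ_le (A : Set Γ.Point) : Γ.length univ ≤ Γ.length A + Γ.length Aᶜ := by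
  rw [length, length, length, ← Finset.sum_add_distrib]
  refine Finset.sum_le_sum fun e _ => (measure_mono fun x hx => ?_).trans (measure_union_le _ _)
  by_cases h : Γ.point e x ∈ A
  · exact Or.inl ⟨hx.1, h⟩
  · exact Or.inr ⟨hx.1, h⟩

/-- The Cheeger constant bounds the perimeter of sets of at most half the total length. -/
theorem cheegerConstant_mul_length_le {D : Set Γ.Point} (hD : Γ.IsMeasurable D)
    (h : 2 * Γ.length D ≤ Γ.length univ) : Γ.cheegerConstant * Γ.length D ≤ Γ.perimeter D := by
  -- Null sets are not competitors in the infimum, but for them the claim is trivial.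
  rcases eq_or_ne (Γ.length D) 0 with h0 | h0
  · simp [h0]
  have hfin : Γ.length univ ≠ ⊤ := by
    rw [length_univ]; exact ENNReal.sum_ne_top.2 fun e _ => ENNReal.ofReal_ne_top
  have hDfin : Γ.length D ≠ ⊤ := by
    refine ne_top_of_le_ne_top hfin (le_trans ?_ h)
    rw [two_mul]; exact le_self_add
  have hlt : Γ.length D < Γ.length univ := by
    refine lt_of_lt_of_le ?_ h
    rw [two_mul]
    exact ENNReal.lt_add_right hDfin h0
  have hmin : min (Γ.length D) (Γ.length Dᶜ) = Γ.length D := by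
    refine min_eq_left ?_
    have := h.trans (length_univ_le D)
    rw [two_mul] at this
    exact (ENNReal.add_le_add_iff_left hDfin).1 this
  rw [← ENNReal.le_div_iff_mul_le (Or.inl h0) (Or.inl hDfin)]
  refine (iInf_le_of_le D (iInf_le_of_le hD (iInf_le_of_le (pos_iff_ne_zero.2 h0)
    (iInf_le_of_le hlt ?_))))
  rw [hmin]

/-- The functional form of the isoperimetric inequality, for positive parts. -/
theorem cheegerConstant_mul_lintegral_le [Finite V] {F F' : E → ℝ → ℝ}
    (hF : ∀ e x, HasDerivAt (F e) (F' e x) x) (hF' : ∀ e, Continuous (F' e))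
    (hc : Γ.ContinuousAtVertices F)
    (h : 2 * ∑ e, volume.restrict (Icc 0 (Γ.len e)) {x | 0 < F e x} ≤ Γ.length univ) :
    Γ.cheegerConstant * ∑ e, ∫⁻ x in Icc 0 (Γ.len e), ENNReal.ofReal (F e x)
      ≤ ∑ e, ∫⁻ x in Icc 0 (Γ.len e), if 0 < F e x then ‖F' e x‖ₑ else 0 := by
  obtain ⟨c, hc⟩ := hc
  have hFc : ∀ e, Continuous (F e) := fun e =>
    continuous_iff_continuousAt.2 fun x => (hF e x).continuousAt
  have hmeas : ∀ e t, MeasurableSet {x | t < F e x} := fun e t =>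
    measurableSet_lt measurable_const (hFc e).measurable
  have hlen : ∀ t, Γ.length (Γ.superlevel c F t)
      = ∑ e, volume.restrict (Icc 0 (Γ.len e)) {x | t < F e x} := by
    intro t
    refine Finset.sum_congr rfl fun e _ => ?_
    rw [coords_superlevel hc, Measure.restrict_apply (hmeas e t), inter_comm]
    rfl
  have hanti : ∀ e, Antitone fun t => volume.restrict (Icc 0 (Γ.len e)) {x | t < F e x} :=
    fun e s t hst => measure_mono fun x hx => lt_of_le_of_lt hst hx
  have hlayer : ∑ e, ∫⁻ x in Icc 0 (Γ.len e), ENNReal.ofReal (F e x)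
      = ∫⁻ t in Ioi 0, Γ.length (Γ.superlevel c F t) := by
    simp only [hlen]
    rw [lintegral_finsetSum _ fun e _ => (hanti e).measurable]
    refine Finset.sum_congr rfl fun e _ => ?_
    -- The layer cake formula needs a nonnegative function; the positive part has the same
    -- superlevel sets at positive levels.
    have h1 := lintegral_eq_lintegral_meas_lt (volume.restrict (Icc 0 (Γ.len e)))
      (f := fun x => max (F e x) 0) (ae_of_all _ fun x => le_max_right _ _)
      ((hFc e).max continuous_const).aemeasurable
    rw [← setLIntegral_congr_fun (f := fun t => volume.restrict (Icc 0 (Γ.len e))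
      {x | t < max (F e x) 0}) measurableSet_Ioi, ← h1]
    · refine lintegral_congr fun x => ?_
      simp [ENNReal.ofReal_max]
    · intro t ht
      have ht' : ¬ t < 0 := not_lt.2 (le_of_lt ht)
      simp [ht']
  rw [hlayer]
  refine (lintegral_const_mul_le _ _).trans ?_
  refine le_trans ?_ (lintegral_perimeter_superlevel_le hF hF' hc)
  refine setLIntegral_mono' measurableSet_Ioi fun t ht => ?_
  refine cheegerConstant_mul_length_le (fun e => ?_) ?_
  · rw [coords_superlevel hc]
    exact (measurableSet_Icc.inter (hmeas e t)).nullMeasurableSet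
  · refine le_trans ?_ h
    rw [hlen]
    exact mul_le_mul_right (Finset.sum_le_sum fun e _ => hanti e (le_of_lt ht)) 2

theorem sum_lintegral_ofReal {f : E → ℝ → ℝ} (hf : ∀ e, Continuous (f e))
    (h0 : ∀ e x, 0 ≤ f e x) :
    ∑ e, ∫⁻ x in Icc 0 (Γ.len e), ENNReal.ofReal (f e x) = ENNReal.ofReal (Γ.integral f) := by
  rw [integral, ENNReal.ofReal_sum_of_nonneg fun e _ =>
    intervalIntegral.integral_nonneg (Γ.len_pos e).le fun x _ => h0 e x]
  refine Finset.sum_congr rfl fun e _ => ?_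
  rw [intervalIntegral.integral_of_le (Γ.len_pos e).le, ← integral_Icc_eq_integral_Ioc,
    ofReal_integral_eq_lintegral_ofReal ((hf e).integrableOn_Icc) (ae_of_all _ (h0 e))]

/-- The isoperimetric inequality for the signed square of a function with median zero. -/
theorem cheegerConstant_mul_integral_sq_le [Finite V] {v g : E → ℝ → ℝ}
    (hv : ∀ e x, HasDerivAt (v e) (g e x) x) (hg : ∀ e, Continuous (g e))
    (hc : Γ.ContinuousAtVertices v)
    (hpos : 2 * ∑ e, volume.restrict (Icc 0 (Γ.len e)) {x | 0 < v e x} ≤ Γ.length univ)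
    (hneg : 2 * ∑ e, volume.restrict (Icc 0 (Γ.len e)) {x | v e x < 0} ≤ Γ.length univ) :
    Γ.cheegerConstant * ENNReal.ofReal (Γ.integral fun e x => v e x ^ 2)
      ≤ ENNReal.ofReal (Γ.integral fun e x => 2 * |v e x| * |g e x|) := by
  have hvc : ∀ e, Continuous (v e) := fun e =>
    continuous_iff_continuousAt.2 fun x => (hv e x).continuousAt
  have hF : ∀ e x, HasDerivAt (fun x => v e x * |v e x|) (2 * |v e x| * g e x) x := fun e x =>
    (hasDerivAt_mul_abs (v e x)).comp x (hv e x)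
  have hF' : ∀ e, Continuous fun x => 2 * |v e x| * g e x := fun e =>
    (continuous_const.mul (hvc e).abs).mul (hg e)
  obtain ⟨c, hc⟩ := hc
  have hsign : ∀ s : ℝ, 0 < s * |s| ↔ 0 < s := fun s => by
    constructor
    · intro h
      by_contra hs
      exact absurd h (not_lt.2 (mul_nonpos_of_nonpos_of_nonneg (not_lt.1 hs) (abs_nonneg s)))
    · intro h; exact mul_pos h (abs_pos.2 h.ne')
  have hsign' : ∀ s : ℝ, 0 < -(s * |s|) ↔ s < 0 := fun s => by
    have := hsign (-s)
    rw [abs_neg, neg_mul, neg_pos (a := s)] at this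
    exact this
  have h1 := cheegerConstant_mul_lintegral_le (Γ := Γ) hF hF'
    ⟨fun w => c w * |c w|, fun e => by simp only [(hc e).1, (hc e).2, and_self]⟩
    (by simpa only [hsign] using hpos)
  have h2 := cheegerConstant_mul_lintegral_le (Γ := Γ) (fun e x => (hF e x).neg)
    (fun e => (hF' e).neg)
    ⟨fun w => -(c w * |c w|), fun e => by simp only [Pi.neg_apply, (hc e).1, (hc e).2, and_self]⟩
    (by simpa only [Pi.neg_apply, hsign'] using hneg)
  -- Pointwise, the positive and negative parts of v|v| add up to v², while the sets {v > 0} and {v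
  -- < 0} are disjoint, so |F'| is counted at most once.
  have h3 := add_le_add h1 h2
  rw [← mul_add, ← Finset.sum_add_distrib, ← Finset.sum_add_distrib] at h3
  rw [← sum_lintegral_ofReal (f := fun e x => v e x ^ 2) (fun e => (hvc e).pow 2) (fun e x => sq_nonneg _),
    ← sum_lintegral_ofReal (f := fun e x => 2 * |v e x| * |g e x|)
      (fun e => (continuous_const.mul (hvc e).abs).mul (hg e).abs)
      (fun e x => by positivity)]
  refine (le_of_eq ?_).trans (h3.trans (Finset.sum_le_sum fun e _ => ?_))
  · congr 1
    refine Finset.sum_congr rfl fun e _ => ?_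
    rw [← lintegral_add_left (by have := hvc e; fun_prop)]
    refine lintegral_congr fun x => ?_
    rcases le_total 0 (v e x) with h | h
    · rw [abs_of_nonneg h, Pi.neg_apply, abs_of_nonneg h,
        ENNReal.ofReal_of_nonpos (by nlinarith : -(v e x * v e x) ≤ 0), add_zero, sq]
    · rw [Pi.neg_apply, abs_of_nonpos h,
        ENNReal.ofReal_of_nonpos (by nlinarith : v e x * -v e x ≤ 0), zero_add]
      congr 1; ring
  · rw [← lintegral_add_left (Measurable.ite (measurableSet_lt measurable_const
      (by have := hvc e; fun_prop)) (hF' e).enorm.measurable measurable_const)]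
    refine lintegral_mono fun x => ?_
    have e1 : ENNReal.ofReal (2 * |v e x| * |g e x|) = ‖2 * |v e x| * g e x‖ₑ := by
      rw [Real.enorm_eq_ofReal_abs, abs_mul, abs_mul, abs_abs, abs_two]
    simp only [Pi.neg_apply, hsign, hsign', e1, enorm_neg]
    rcases lt_trichotomy (v e x) 0 with h | h | h
    · simp [h, not_lt.2 h.le]
    · simp [h]
    · simp [h, not_lt.2 h.le]

/-- With A = ∫(u - m)² and P = 2∫|u - m||u'|, the isoperimetric inequality gives h ≤ P/A, while P² ≤
4Aλ and A ≥ 1. -/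
theorem sq_cheegerConstant_div_four_le [Finite V] [Nonempty E]
    (hΓ : Γ.toSimpleGraph.Connected) :
    Γ.cheegerConstant ^ 2 / 4 ≤ ENNReal.ofReal (sInf Γ.rayleighQuotients) := by
  obtain ⟨u, g, hu, hg, ⟨c, hc⟩, -, h1, hm, hq⟩ := exists_eigenfunction hΓ
  set lam := sInf Γ.rayleighQuotients
  have hlen : ∀ e, (0 : ℝ) ≤ Γ.len e := fun e => (Γ.len_pos e).le
  -- The eigenfunction is only controlled on the edges, whereas the coarea lemmas ask for
  -- derivatives on the whole line: extend u' constantly beyond each edge and integrate it.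
  set G : E → ℝ → ℝ := fun e => IccExtend (hlen e) ((Icc 0 (Γ.len e)).domRestrict (g e))
  have hGc : ∀ e, Continuous (G e) := fun e => (hg e).continuousOn.domRestrict.Icc_extend'
  have hGg : ∀ e, ∀ x ∈ Icc 0 (Γ.len e), G e x = g e x := fun e x hx =>
    IccExtend_of_mem _ _ hx
  set U : E → ℝ → ℝ := fun e x => u e 0 + ∫ t in 0..x, G e t
  have hUd : ∀ e x, HasDerivAt (U e) (G e x) x := fun e x =>
    ((hGc e).integral_hasStrictDerivAt 0 x).hasDerivAt.const_add _
  have hUu : ∀ e, ∀ x ∈ Icc 0 (Γ.len e), U e x = u e x := by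
    intro e x hx
    rw [hu.eq_add_integral e hx]
    refine congrArg (u e 0 + ·) (intervalIntegral.integral_congr fun t ht => ?_)
    rw [uIcc_of_le hx.1] at ht
    exact hGg e t ⟨ht.1, ht.2.trans hx.2⟩
  have hUc : ∀ e, Continuous (U e) := fun e =>
    continuous_iff_continuousAt.2 fun x => (hUd e x).continuousAt
  have h0m : ∀ e, (0 : ℝ) ∈ Icc 0 (Γ.len e) := fun e => ⟨le_rfl, hlen e⟩
  have h1m : ∀ e, Γ.len e ∈ Icc 0 (Γ.len e) := fun e => ⟨hlen e, le_rfl⟩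
  have hUC : Γ.ContinuousAtVertices U := ⟨c, fun e => by
    rw [hUu e _ (h0m e), hUu e _ (h1m e)]; exact hc e⟩
  have hint : ∀ {f f' : E → ℝ → ℝ}, (∀ e, ∀ x ∈ Icc 0 (Γ.len e), f e x = f' e x) →
      Γ.integral f = Γ.integral f' := by
    intro f f' h
    refine Finset.sum_congr rfl fun e _ => intervalIntegral.integral_congr fun x hx => ?_
    rw [uIcc_of_le (hlen e)] at hx
    exact h e x hx
  -- The distribution of the eigenfunction under the length measure; its median splits the graph in
  -- half.
  set μ : Measure ℝ := ∑ e, (volume.restrict (Icc 0 (Γ.len e))).map (U e)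
  have hμ : ∀ s, MeasurableSet s → μ s = ∑ e, volume.restrict (Icc 0 (Γ.len e)) (U e ⁻¹' s) := by
    intro s hs
    rw [Measure.finsetSum_apply]
    exact Finset.sum_congr rfl fun e _ => Measure.map_apply (hUc e).measurable hs
  have hμu : μ univ = Γ.length univ := by
    rw [hμ _ MeasurableSet.univ, length_univ]
    simp
  obtain ⟨m, hm1, hm2⟩ := exists_median μ
  rw [hμ _ measurableSet_Ioi, hμu] at hm1
  rw [hμ _ measurableSet_Iio, hμu] at hm2
  have hmain := cheegerConstant_mul_integral_sq_le (Γ := Γ) (v := fun e x => U e x - m) (g := G)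
    (fun e x => (hUd e x).sub_const m) hGc
    (by obtain ⟨d, hd⟩ := hUC
        exact ⟨fun w => d w - m, fun e => by simp only [(hd e).1, (hd e).2, and_self]⟩)
    (by simpa only [sub_pos, preimage, mem_Ioi] using hm1)
    (by simpa only [sub_neg, preimage, mem_Iio] using hm2)
  set A := Γ.integral fun e x => (U e x - m) ^ 2 with hA
  set P := Γ.integral fun e x => 2 * |U e x - m| * |G e x| with hP
  have hUL : Γ.IsL2 U := isL2_of_continuousOn fun e => (hUc e).continuousOn
  have hGL : Γ.IsL2 G := isL2_of_continuousOn fun e => (hGc e).continuousOn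
  -- The cross term vanishes since u has mean zero, so A = 1 + m² times the total length.
  have hA1 : 1 ≤ A := by
    have e1 : A = Γ.integral (fun e x => (1 * u e x + (-m) * 1) ^ 2) :=
      hint fun e x hx => by rw [hUu e x hx]; ring
    rw [e1, integral_sq_lin hu.isL2 (isW12_const 1).isL2, h1]
    simp only [mul_one]
    rw [hm, integral_const]
    have := mul_nonneg (sq_nonneg m) (Γ.sum_len_pos).le
    simp only [one_pow, one_mul, neg_sq]
    linarith
  have hPA : P ^ 2 ≤ 4 * A * lam := by
    have e1 : P = 2 * Γ.integral (fun e x => |U e x - m| * |G e x|) := by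
      rw [← integral_const_mul, hP]; congr 1; ext e x; ring
    have e2 := sq_integral_mul_le (Γ := Γ) (g := fun e x => |U e x - m|) (h := fun e x => |G e x|)
      (isL2_of_continuousOn fun e => ((hUc e).sub continuous_const).abs.continuousOn)
      (isL2_of_continuousOn fun e => (hGc e).abs.continuousOn)
    simp only [sq_abs] at e2
    rw [hint (f := fun e x => G e x ^ 2) (f' := fun e x => g e x ^ 2)
      (fun e x hx => by rw [hGg e x hx]), hq] at e2
    rw [e1]
    linarith
  have hApos : 0 < A := by linarith
  have hP0 : 0 ≤ P := Finset.sum_nonneg fun e _ =>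
    intervalIntegral.integral_nonneg (hlen e) fun x _ => by positivity
  have hlam0 : 0 ≤ lam := hq ▸ Γ.integral_sq_nonneg g
  have hh : Γ.cheegerConstant ≤ ENNReal.ofReal (P / A) := by
    rw [ENNReal.ofReal_div_of_pos hApos, ENNReal.le_div_iff_mul_le
      (Or.inl (by simpa using hApos)) (Or.inl ENNReal.ofReal_ne_top)]
    exact hmain
  refine (ENNReal.div_le_of_le_mul ?_)
  rw [show (4 : ℝ≥0∞) = ENNReal.ofReal 4 by simp, ← ENNReal.ofReal_mul hlam0]
  refine (pow_le_pow_left₀ zero_le hh 2).trans ?_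
  rw [← ENNReal.ofReal_pow (by positivity)]
  refine ENNReal.ofReal_le_ofReal ?_
  rw [div_pow, div_le_iff₀ (by positivity)]
  have : 4 * A * lam ≤ lam * 4 * A ^ 2 := by
    have := mul_le_mul_of_nonneg_left hA1 (mul_nonneg hlam0 hApos.le)
    nlinarith
  linarith

end Finite

end MetricGraph

/-! ### The theorem -/

theorem mainTheorem7 {V E : Type*} [Finite V] [Fintype E] [Nonempty E] (Γ : MetricGraph V E)
    (hΓ : Γ.toSimpleGraph.Connected) :
    IsLeast Γ.nonzeroEigenvalues Γ.spectralGap ∧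
      IsLeast Γ.rayleighQuotients Γ.spectralGap ∧
      Γ.cheegerConstant ^ 2 / 4 ≤ ENNReal.ofReal Γ.spectralGap := by
  rw [MetricGraph.spectralGap_eq_sInf_rayleighQuotients hΓ]
  have h := MetricGraph.isLeast_nonzeroEigenvalues_sInf_rayleighQuotients hΓ
  -- The minimum in the variational formula is attained because the least nonzero eigenvalue is
  -- itself a Rayleigh quotient.
  exact ⟨h, ⟨Γ.nonzeroEigenvalues_subset_rayleighQuotients h.1,
    fun _ hr => csInf_le MetricGraph.bddBelow_rayleighQuotients hr⟩,
    MetricGraph.sq_cheegerConstant_div_four_le hΓ⟩
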